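/- Let $n\ge 3$. For a cubic form (homogeneous polynomial of degree $3$) $C\in\mathbb Z[X_1,\dots,X_n]$ let $M=\|C\|$ denote the maximum modulus of its coefficients. Write $C(\mathbf x)=\sum_{i,j,k}c_{ijk}x_ix_jx_k$ with rational coefficients $c_{ijk}$ symmetric in $i,j,k$, and for $\mathbf x\in\mathbb Z^n$ let $M(\mathbf x)$ be the $n\times n$ matrix with entries $M(\mathbf x)_{jk}=\sum_{i}c_{ijk}x_i$. Put $|\mathbf x|=\max_i|x_i|$. Let $\Lambda_n(C)$ be the least positive integer $\lambda$ such that, if $C=0$ has a non-zero integer solution, then it has a non-zero integer solution $\mathbf x$ with $|\mathbf x|\le\lambda$. There exist a constant $c_{n,\varepsilon}$ for each $\varepsilon>0$, depending only on $n$ and $\varepsilon$, and a constant $c_n$ depending only on $n$, such that for every cubic form $C\in\mathbb Z[X_1,\dots,X_n]$ and every real $\psi\ge 1$ at least one of the following holds. (i) $C$ is $\psi$-good: for every $\varepsilon>0$, every integer $0\le r\le n$ and every real $H$ with $1\le H\le M^{\psi}$, $$\#\{\mathbf x\in\mathbb Z^n:\ |\mathbf x|\le H,\ \operatorname{rank}M(\mathbf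 x)=r\}\le c_{n,\varepsilon}H^{r+\varepsilon}.$$ (ii) The equation $C(\mathbf x)=0$ has a non-zero solution $\mathbf x\in\mathbb Z^n$, and $$\Lambda_n(C)\le c_n\,M^{\frac{n^2}{2}-1+\frac{\psi n(n-1)}{2}}.$$ -/

import Mathlib

/-- The height `‖C‖`: the maximum modulus of the coefficients of the polynomial `C`. -/
noncomputable def cubicHeight {n : ℕ} (C : MvPolynomial (Fin n) ℤ) : ℕ :=
  C.support.sup fun m => (C.coeff m).natAbs

/-- The symmetric coefficients `c_{ijk}` of a cubic form `C = ∑ c_{ijk} x_i x_j x_k`, as rational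
numbers: `c_{ijk} = (1/6) ∂³C / ∂x_i ∂x_j ∂x_k`. -/
noncomputable def symCoeff {n : ℕ} (C : MvPolynomial (Fin n) ℤ) (i j k : Fin n) : ℚ :=
  ((MvPolynomial.constantCoeff
    (MvPolynomial.pderiv i (MvPolynomial.pderiv j (MvPolynomial.pderiv k C))) : ℤ) : ℚ) / 6

/-- Partial derivatives commute. -/
theorem pderiv_comm_aux {n : ℕ} (i j : Fin n) (C : MvPolynomial (Fin n) ℤ) :
    MvPolynomial.pderiv i (MvPolynomial.pderiv j C) =
      MvPolynomial.pderiv j (MvPolynomial.pderiv i C) := by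
  have h : ⁅MvPolynomial.pderiv (R := ℤ) i, MvPolynomial.pderiv (R := ℤ) j⁆ = 0 := by
    apply MvPolynomial.derivation_ext
    intro k
    simp [Derivation.commutator_apply, MvPolynomial.pderiv_X, Pi.single_apply, apply_ite]
  have h2 := congrArg (fun D : Derivation ℤ (MvPolynomial (Fin n) ℤ) (MvPolynomial (Fin n) ℤ) => D C) h
  simp only [Derivation.commutator_apply, Derivation.coe_zero, Pi.zero_apply] at h2
  exact sub_eq_zero.mp h2

/-- The `c_{ijk}` are symmetric: exchange of the first two indices. -/
theorem symCoeff_swap_left {n : ℕ} (C : MvPolynomial (Fin n) ℤ) (i j k : Fin n) :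
    symCoeff C i j k = symCoeff C j i k := by
  unfold symCoeff
  rw [pderiv_comm_aux]

/-- The `c_{ijk}` are symmetric: exchange of the last two indices. -/
theorem symCoeff_swap_right {n : ℕ} (C : MvPolynomial (Fin n) ℤ) (i j k : Fin n) :
    symCoeff C i j k = symCoeff C i k j := by
  unfold symCoeff
  rw [pderiv_comm_aux j k]

/-- Every integral cubic form is `∑ c_{ijk} x_i x_j x_k` with `c_{ijk}` as defined above. -/
theorem eval_eq_sum_symCoeff {n : ℕ} {C : MvPolynomial (Fin n) ℤ} (hC : C.IsHomogeneous 3)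
    (x : Fin n → ℤ) :
    ((MvPolynomial.eval x C : ℤ) : ℚ) =
      ∑ i, ∑ j, ∑ k, symCoeff C i j k * (x i : ℚ) * (x j : ℚ) * (x k : ℚ) := by
  have euler : ∀ (d : ℕ) (F : MvPolynomial (Fin n) ℤ), F.IsHomogeneous d →
      ∑ i, x i * MvPolynomial.eval x (MvPolynomial.pderiv i F) =
        d * MvPolynomial.eval x F := by
    intro d F hF
    have h := congrArg (MvPolynomial.eval x) hF.sum_X_mul_pderiv
    simpa [map_sum, nsmul_eq_mul] using h
  have h0 : ∀ F : MvPolynomial (Fin n) ℤ, F.IsHomogeneous 0 →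
      MvPolynomial.eval x F = MvPolynomial.constantCoeff F := by
    intro F hF
    obtain ⟨a, rfl⟩ : ∃ a, F = MvPolynomial.C a :=
      ⟨_, MvPolynomial.totalDegree_eq_zero_iff_eq_C.mp ((MvPolynomial.totalDegree_zero_iff_isHomogeneous _).mpr hF)⟩
    simp
  have key : (6 : ℤ) * MvPolynomial.eval x C =
      ∑ i, ∑ j, ∑ k, MvPolynomial.constantCoeff
        (MvPolynomial.pderiv i (MvPolynomial.pderiv j (MvPolynomial.pderiv k C)))
          * x i * x j * x k := by
    have e3 := euler 3 C hC
    have e2 := fun k => euler 2 (MvPolynomial.pderiv k C) hC.pderiv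
    have e1 := fun k j => euler 1 (MvPolynomial.pderiv j (MvPolynomial.pderiv k C))
      hC.pderiv.pderiv
    have e0 := fun k j i => h0
      (MvPolynomial.pderiv i (MvPolynomial.pderiv j (MvPolynomial.pderiv k C)))
      hC.pderiv.pderiv.pderiv
    calc (6 : ℤ) * MvPolynomial.eval x C
        = 2 * ∑ k, x k * MvPolynomial.eval x (MvPolynomial.pderiv k C) := by
          rw [e3]; push_cast; ring
      _ = ∑ k, x k * ∑ j, x j * ∑ i, x i * MvPolynomial.constantCoeff
            (MvPolynomial.pderiv i (MvPolynomial.pderiv j (MvPolynomial.pderiv k C))) := by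
          rw [Finset.mul_sum]
          refine Finset.sum_congr rfl fun k _ => ?_
          have h2 := e2 k
          have : ∀ j, ∑ i, x i * MvPolynomial.constantCoeff
              (MvPolynomial.pderiv i (MvPolynomial.pderiv j (MvPolynomial.pderiv k C))) =
              MvPolynomial.eval x (MvPolynomial.pderiv j (MvPolynomial.pderiv k C)) := by
            intro j
            have h1 := e1 k j
            simp only [e0] at h1
            simpa using h1
          simp only [this]
          rw [h2]; push_cast; ring
      _ = ∑ k, ∑ j, ∑ i, MvPolynomial.constantCoeff
            (MvPolynomial.pderiv i (MvPolynomial.pderiv j (MvPolynomial.pderiv k C)))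
              * x i * x j * x k := by
          simp only [Finset.mul_sum]
          refine Finset.sum_congr rfl fun k _ => Finset.sum_congr rfl fun j _ =>
            Finset.sum_congr rfl fun i _ => by ring
      _ = _ := by
          rw [Finset.sum_comm]
          rw [Finset.sum_congr rfl fun j _ => Finset.sum_comm]
          rw [Finset.sum_comm]
  have hq := congrArg (fun z : ℤ => (z : ℚ) / 6) key
  simp only [Int.cast_mul, Int.cast_sum] at hq
  have : ((MvPolynomial.eval x C : ℤ) : ℚ) = ((6 : ℤ) : ℚ) * (MvPolynomial.eval x C : ℤ) / 6 := by
    push_cast; ring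
  rw [this, hq]
  simp only [Finset.sum_div, symCoeff]
  refine Finset.sum_congr rfl fun i _ => Finset.sum_congr rfl fun j _ =>
    Finset.sum_congr rfl fun k _ => by ring

/-- The matrix `M(x)`, with entries `M(x)_{jk} = ∑_i c_{ijk} x_i`. -/
noncomputable def cubicMatrix {n : ℕ} (C : MvPolynomial (Fin n) ℤ) (x : Fin n → ℤ) :
    Matrix (Fin n) (Fin n) ℚ :=
  Matrix.of fun j k => ∑ i, symCoeff C i j k * (x i : ℚ)

/-- The number of integer points `x` with `|x| ≤ H` (maximum norm) and `rank M(x) = r`. -/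
noncomputable def rankCount {n : ℕ} (C : MvPolynomial (Fin n) ℤ) (r : ℕ) (H : ℝ) : ℕ :=
  Set.ncard {x : Fin n → ℤ | ‖x‖ ≤ H ∧ (cubicMatrix C x).rank = r}

/-- `C` is `ψ`-good with implied constants `K ε`: for every `ε > 0`, every `0 ≤ r ≤ n` and every
real `1 ≤ H ≤ ‖C‖ ^ ψ`, at most `K ε * H ^ (r + ε)` integer points `|x| ≤ H` have
`rank M(x) = r`. -/
def IsPsiGood {n : ℕ} (K : ℝ → ℝ) (ψ : ℝ) (C : MvPolynomial (Fin n) ℤ) : Prop :=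
  ∀ ε : ℝ, 0 < ε → ∀ r : ℕ, r ≤ n → ∀ H : ℝ, 1 ≤ H → H ≤ (cubicHeight C : ℝ) ^ ψ →
    (rankCount C r H : ℝ) ≤ K ε * H ^ ((r : ℝ) + ε)

/-- `x` is a non-trivial integer zero of `C`. -/
def IsNontrivialZero {n : ℕ} (C : MvPolynomial (Fin n) ℤ) (x : Fin n → ℤ) : Prop :=
  x ≠ 0 ∧ MvPolynomial.eval x C = 0

/-- `Λ_n(C)`: the least positive integer `l` such that, if `C` has a non-trivial integer zero, then
it has one with `|x| ≤ l` (maximum norm). -/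
noncomputable def leastZeroBound {n : ℕ} (C : MvPolynomial (Fin n) ℤ) : ℕ :=
  sInf {l : ℕ | 0 < l ∧
    ((∃ x, IsNontrivialZero C x) → ∃ x, IsNontrivialZero C x ∧ ‖x‖ ≤ (l : ℝ))}

/-! Fix `r` and let S(x) = 6M(x) be the Hessian. Near a point x of rank `r` with nonzero principal
minor on the rows `e`, the rank locus is cut out by S(x)P(x) = 0, where P is `kernelMatrix`, whose
columns are killed by the rows `e` of S. The entries of SP are the bordered minors.

Suppose a nonzero Y lies both in the kernel of S(x) and in the kernel of all gradients of these
minors at x. Differentiating SP = 0 along Y and multiplying by Pᵀ on the left removes the derivative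
of P and leaves Pᵀ S(Y) P = 0. Since PY is a nonzero multiple of Y, it follows that Yᵀ S(Y) Y =
6C(Y) = 0 (`eval_eq_zero_of_tangent`). The conditions on Y are linear, with coefficients bounded in
terms of ‖C‖ and H, so Cramer's rule gives a small integral Y (`exists_small_solution`).

If no such Y exists for any x in the box, the gradients together with at most `r` coordinate vectors
span the space. After fixing those coordinates, in O(H^r) ways, x is a nondegenerate zero of a
square system of bounded degree, and a weak Bézout bound (`card_nondegenerate_zeros_le`) leaves O(1)
choices. So the count is O(H^r), with no need for ε. -/

open scoped Matrix

/-! ### A Bézout-type bound for nondegenerate real zeros -/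

theorem MvPolynomial.hasStrictFDerivAt_eval {σ : Type*} [Fintype σ] (p : MvPolynomial σ ℝ)
    (z : σ → ℝ) :
    HasStrictFDerivAt (fun x : σ → ℝ => MvPolynomial.eval x p)
      (∑ i, MvPolynomial.eval z (MvPolynomial.pderiv i p) •
        (ContinuousLinearMap.proj i : (σ → ℝ) →L[ℝ] ℝ)) z := by
  classical
  induction p using MvPolynomial.induction_on with
  | C a => simpa using hasStrictFDerivAt_const a z
  | add p q hp hq =>
    have := hp.add hq
    simp only [map_add, add_smul, Finset.sum_add_distrib]
    exact this
  | mul_X p i hp =>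
    have hX : HasStrictFDerivAt (fun x : σ → ℝ => x i)
        (ContinuousLinearMap.proj i : (σ → ℝ) →L[ℝ] ℝ) z :=
      (ContinuousLinearMap.proj (R := ℝ) (φ := fun _ : σ => ℝ) i).hasStrictFDerivAt
    have := hp.mul hX
    simp only [map_mul, MvPolynomial.eval_X]
    refine this.congr_fderiv ?_
    ext v
    simp [MvPolynomial.pderiv_X, Pi.single_apply, add_mul, Finset.sum_add_distrib, Finset.mul_sum,
      apply_ite]
    exact Finset.sum_congr rfl fun j _ => by ring

/-- A nondegenerate zero of a square real polynomial system persists under small perturbations. -/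
theorem eventually_exists_zero_perturbed {σ : Type*} [Fintype σ] (f : σ → MvPolynomial σ ℝ)
    (D : ℕ) (z : σ → ℝ) (hz : ∀ a, MvPolynomial.eval z (f a) = 0)
    (hnd : ∀ v : σ → ℝ,
      (∀ a, ∑ i, MvPolynomial.eval z (MvPolynomial.pderiv i (f a)) * v i = 0) → v = 0)
    (U : Set (σ → ℝ)) (hU : U ∈ nhds z) :
    ∀ᶠ t in nhds (0 : ℝ), ∃ x ∈ U, ∀ a, t * x a ^ D + MvPolynomial.eval x (f a) = 0 := by
  classical
  let J : σ → ((σ → ℝ) →L[ℝ] ℝ) := fun a =>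
    ∑ i, MvPolynomial.eval z (MvPolynomial.pderiv i (f a)) •
      (ContinuousLinearMap.proj i : (σ → ℝ) →L[ℝ] ℝ)
  -- Keeping t as a coordinate makes the derivative at (0, z) block triangular with diagonal blocks
  -- 1 and the Jacobian. It is therefore invertible, `G` is open there, and (t, 0) has a preimage
  -- near (0, z).
  let G : ℝ × (σ → ℝ) → ℝ × (σ → ℝ) := fun q =>
    (q.1, fun a => q.1 * q.2 a ^ D + MvPolynomial.eval q.2 (f a))
  let L : ℝ × (σ → ℝ) →L[ℝ] ℝ × (σ → ℝ) :=
    (ContinuousLinearMap.fst ℝ ℝ (σ → ℝ)).prod (ContinuousLinearMap.pi fun a =>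
      (z a ^ D) • ContinuousLinearMap.fst ℝ ℝ (σ → ℝ) +
        (J a).comp (ContinuousLinearMap.snd ℝ ℝ (σ → ℝ)))
  have hG : HasStrictFDerivAt G L (0, z) := by
    refine hasStrictFDerivAt_fst.prodMk ?_
    rw [hasStrictFDerivAt_pi']
    intro a
    have h1 : HasStrictFDerivAt (fun q : ℝ × (σ → ℝ) => MvPolynomial.eval q.2 (f a))
        ((J a).comp (ContinuousLinearMap.snd ℝ ℝ (σ → ℝ))) (0, z) :=
      HasStrictFDerivAt.comp (f := Prod.snd) ((0 : ℝ), z)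
        (MvPolynomial.hasStrictFDerivAt_eval (f a) z)
        hasStrictFDerivAt_snd
    have h2 : HasStrictFDerivAt (fun q : ℝ × (σ → ℝ) => MvPolynomial.eval q.2
        (MvPolynomial.X a ^ D : MvPolynomial σ ℝ)) _ (0, z) :=
      HasStrictFDerivAt.comp (f := Prod.snd) ((0 : ℝ), z)
        (MvPolynomial.hasStrictFDerivAt_eval _ z)
        hasStrictFDerivAt_snd
    simp only [map_pow, MvPolynomial.eval_X] at h2
    have h3 := (hasStrictFDerivAt_fst (𝕜 := ℝ) (p := ((0 : ℝ), z))).mul h2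
    have := h3.add h1
    refine this.congr_fderiv ?_
    ext v <;> simp
  have hLinj : Function.Injective (L : ℝ × (σ → ℝ) →ₗ[ℝ] ℝ × (σ → ℝ)) := by
    rw [← LinearMap.ker_eq_bot, LinearMap.ker_eq_bot']
    rintro ⟨s, v⟩ hv
    have hs : s = 0 := congrArg Prod.fst hv
    subst hs
    have hv' : v = 0 := by
      apply hnd
      intro a
      have := congrFun (congrArg Prod.snd hv) a
      simpa [L, J] using this
    simp [hv']
  have hLsurj : L.range = ⊤ := by
    rw [LinearMap.range_eq_top]
    exact LinearMap.injective_iff_surjective.mp hLinj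
  have hmap := hG.map_nhds_eq_of_surj hLsurj
  have hG0 : G (0, z) = (0, 0) := by
    ext a <;> simp [G, hz]
  rw [hG0] at hmap
  have hV : G '' (Prod.snd ⁻¹' U) ∈ nhds ((0 : ℝ), (0 : σ → ℝ)) := by
    rw [← hmap]
    exact Filter.image_mem_map (continuousAt_snd.preimage_mem_nhds hU)
  have hc : Filter.Tendsto (fun t : ℝ => (t, (0 : σ → ℝ))) (nhds 0) (nhds (0, 0)) :=
    (Continuous.prodMk continuous_id continuous_const).tendsto 0
  filter_upwards [hc hV] with t ht
  obtain ⟨⟨s, x⟩, hx, hxe⟩ := ht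
  have hs : s = t := congrArg Prod.fst hxe
  subst hs
  exact ⟨x, hx, fun a => congrFun (congrArg Prod.snd hxe) a⟩

/-- A square system `c x_a ^ D + f_a(x) = 0` with `deg f_a < D` has at most `D ^ n` zeros. -/
theorem card_zeros_le_pow {σ K : Type*} [Fintype σ] [Field K] (f : σ → MvPolynomial σ K) (D : ℕ)
    (hD : ∀ a, (f a).totalDegree < D) (c : K) (hc : c ≠ 0) (Z : Finset (σ → K))
    (hZ : ∀ z ∈ Z, ∀ a, c * z a ^ D + MvPolynomial.eval z (f a) = 0) :
    Z.card ≤ D ^ Fintype.card σ := by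
  classical
  rcases isEmpty_or_nonempty σ with hσ | hσ
  · simpa using Finset.card_le_one_of_subsingleton Z
  let ev : MvPolynomial σ K →ₗ[K] (Z → K) :=
    LinearMap.pi fun z => (MvPolynomial.aeval (R := K) z.1).toLinearMap
  have hev : ∀ p z, ev p z = MvPolynomial.eval z.1 p := fun p z => by
    simp [ev, MvPolynomial.aeval_eq_eval]
  -- The restrictions to `Z` of the D^n monomials with all exponents below `D` will be shown to span
  -- every function on `Z`; comparing dimensions then bounds |Z|.
  let b : (σ → Fin D) → (Z → K) := fun m z => ∏ i, z.1 i ^ (m i : ℕ)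
  let W : Submodule K (Z → K) := Submodule.span K (Set.range b)
  have hpoly : ∀ (k : ℕ), (∀ m : σ →₀ ℕ, m.degree < k → ev (MvPolynomial.monomial m 1) ∈ W) →
      ∀ p : MvPolynomial σ K, (∀ m ∈ p.support, m.degree < k) → ev p ∈ W := by
    intro k hk p hp
    rw [p.as_sum, map_sum]
    refine W.sum_mem fun m hm => ?_
    have : MvPolynomial.monomial m (p.coeff m) =
        p.coeff m • (MvPolynomial.monomial m (1 : K)) := by
      simp [MvPolynomial.smul_monomial]
    rw [this, map_smul]
    exact W.smul_mem _ (hk m (hp m hm))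
  have hmono : ∀ (k : ℕ) (m : σ →₀ ℕ), m.degree < k → ev (MvPolynomial.monomial m 1) ∈ W := by
    intro k
    induction k with
    | zero => intro m hm; omega
    | succ k ih =>
      intro m hm
      by_cases hlt : ∀ i, m i < D
      · refine Submodule.subset_span ⟨fun i => ⟨m i, hlt i⟩, ?_⟩
        ext z
        rw [hev]
        simp [b, MvPolynomial.eval_monomial, Finsupp.prod_fintype]
      · push Not at hlt
        obtain ⟨i, hi⟩ := hlt
        obtain ⟨m', rfl⟩ : ∃ m', m = Finsupp.single i D + m' :=
          ⟨m - Finsupp.single i D, (add_tsub_cancel_of_le (by simpa using hi)).symm⟩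
        -- On `Z` the equations allow x_i^D to be replaced by -c⁻¹ f_i, which lowers the total
        -- degree because deg f_i < D.
        have key : ev (MvPolynomial.monomial (Finsupp.single i D + m') 1) =
            (-c⁻¹) • ev (MvPolynomial.monomial m' 1 * f i) := by
          ext z
          have h0 := hZ z.1 z.2 i
          have h1 : z.1 i ^ D = -c⁻¹ * MvPolynomial.eval z.1 (f i) := by
            field_simp
            linear_combination h0
          rw [Pi.smul_apply, hev, hev, smul_eq_mul, MvPolynomial.monomial_single_add, map_mul,
            map_mul, map_pow, MvPolynomial.eval_X, h1]
          ring
        rw [key]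
        refine W.smul_mem _ (hpoly k ih _ fun q hq => ?_)
        have h1 := MvPolynomial.support_mul _ _ hq
        obtain ⟨u, hu, v, hv, rfl⟩ := Finset.mem_add.mp h1
        have hu' : u = m' := by
          have := MvPolynomial.support_monomial_subset hu
          simpa using this
        subst hu'
        have hvd : v.degree ≤ (f i).totalDegree := MvPolynomial.le_totalDegree hv
        have := hD i
        simp only [map_add, Finsupp.degree_single] at hm ⊢
        omega
  have hall : ∀ p, ev p ∈ W := fun p =>
    hpoly (p.totalDegree + 1) (hmono _) p fun m hm =>
      Nat.lt_succ_of_le (MvPolynomial.le_totalDegree hm)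
  have htop : W = ⊤ := by
    rw [eq_top_iff, ← (Pi.basisFun K Z).span_eq, Submodule.span_le]
    rintro _ ⟨z, rfl⟩
    -- Lagrange interpolation: a product of linear factors, each separating z from one other point,
    -- is the indicator function of z on `Z`.
    have hsep : ∀ w : Z, ∃ i, w ≠ z → z.1 i ≠ w.1 i := by
      intro w
      by_cases h : w = z
      · exact ⟨hσ.some, fun h' => (h' h).elim⟩
      · obtain ⟨i, hi⟩ := Function.ne_iff.mp (fun h' : z.1 = w.1 => h (Subtype.ext h'.symm))
        exact ⟨i, fun _ => hi⟩
    choose idx hidx using hsep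
    have : (Pi.basisFun K Z) z = ev (∏ w ∈ Finset.univ.erase z,
        MvPolynomial.C (z.1 (idx w) - w.1 (idx w))⁻¹ *
          (MvPolynomial.X (idx w) - MvPolynomial.C (w.1 (idx w)))) := by
      ext w
      rw [hev, map_prod]
      by_cases h : w = z
      · subst h
        rw [Finset.prod_eq_one]
        · simp
        · intro u hu
          have := hidx u (Finset.ne_of_mem_erase hu)
          simp [inv_mul_cancel₀ (sub_ne_zero.mpr this)]
      · rw [Finset.prod_eq_zero (i := w) (by simp [h])]
        · simp [h]
        · simp
    rw [SetLike.mem_coe, this]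
    exact hall _
  have h1 : Module.finrank K W ≤ Fintype.card (σ → Fin D) := finrank_range_le_card b
  rw [htop, finrank_top] at h1
  simpa using h1

/-- A square real polynomial system in `n` variables of degree less than `D` has at most `D ^ n`
nondegenerate zeros. -/
theorem card_nondegenerate_zeros_le {σ : Type*} [Fintype σ] (f : σ → MvPolynomial σ ℝ) (D : ℕ)
    (hD : ∀ a, (f a).totalDegree < D) (Z : Finset (σ → ℝ))
    (hZ : ∀ z ∈ Z, ∀ a, MvPolynomial.eval z (f a) = 0)
    (hnd : ∀ z ∈ Z, ∀ v : σ → ℝ,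
      (∀ a, ∑ i, MvPolynomial.eval z (MvPolynomial.pderiv i (f a)) * v i = 0) → v = 0) :
    Z.card ≤ D ^ Fintype.card σ := by
  classical
  obtain ⟨U, hU, hdisj⟩ := Z.finite_toSet.t2_separation
  have hev : ∀ᶠ t in nhdsWithin (0 : ℝ) {0}ᶜ, ∀ z ∈ Z,
      ∃ x ∈ U z, ∀ a, t * x a ^ D + MvPolynomial.eval x (f a) = 0 := by
    rw [Filter.eventually_all_finset]
    intro z hz
    exact (eventually_exists_zero_perturbed f D z (hZ z hz) (hnd z hz) (U z)
      ((hU z).2.mem_nhds (hU z).1)).filter_mono nhdsWithin_le_nhds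
  -- The parameter must be nonzero so that x_a^D really is the leading term; hence the punctured
  -- neighbourhood.
  obtain ⟨t, ht, ht0⟩ := (hev.and self_mem_nhdsWithin).exists
  choose! x hxU hx using ht
  have hinj : Set.InjOn x Z := by
    intro z hz w hw hzw
    by_contra hne
    exact Set.disjoint_left.mp (hdisj hz hw hne) (hxU z hz) (hzw ▸ hxU w hw)
  rw [← Finset.card_image_of_injOn hinj]
  refine card_zeros_le_pow f D hD t ht0 _ ?_
  intro y hy
  obtain ⟨z, hz, rfl⟩ := Finset.mem_image.mp hy
  exact hx z hz

/-! ### Linear algebra: Cramer bounds and square subsystems -/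

theorem exists_injective_of_linearIndepOn {n : ℕ} {ι : Type*} (v : ι → Fin n → ℝ) (b : Set ι)
    (hb : LinearIndepOn ℝ v b) (hspan : Submodule.span ℝ (v '' b) = ⊤) :
    ∃ φ : Fin n → ι, Function.Injective φ ∧ Set.range φ = b ∧
      LinearIndependent ℝ (fun k => v (φ k)) := by
  let B : Module.Basis b ℝ (Fin n → ℝ) := Module.Basis.mk hb (by
    rw [← hspan, Set.image_eq_range])
  let e : Fin n ≃ b := (B.indexEquiv (Pi.basisFun ℝ (Fin n))).symm
  refine ⟨fun k => (e k : ι), Subtype.val_injective.comp e.injective, ?_, ?_⟩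
  · have : (fun k => (e k : ι)) = Subtype.val ∘ e := rfl
    rw [this, Set.range_comp, e.surjective.range_eq, Set.image_univ, Subtype.range_coe]
  · exact hb.comp e e.injective

theorem dotProduct_eq_zero_of_mem_span {n : ℕ} {s : Set (Fin n → ℝ)} {Y : Fin n → ℝ}
    (h : ∀ w ∈ s, w ⬝ᵥ Y = 0) {w : Fin n → ℝ} (hw : w ∈ Submodule.span ℝ s) : w ⬝ᵥ Y = 0 := by
  induction hw using Submodule.span_induction with
  | mem w hw => exact h w hw
  | zero => simp
  | add x y _ _ hx hy => rw [add_dotProduct, hx, hy, add_zero]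
  | smul a x _ hx => rw [smul_dotProduct, hx, smul_zero]

theorem eq_zero_of_dotProduct_eq_zero {n : ℕ} {s : Set (Fin n → ℝ)} {Y : Fin n → ℝ}
    (h : ∀ w ∈ s, w ⬝ᵥ Y = 0) (hs : Submodule.span ℝ s = ⊤) : Y = 0 :=
  dotProduct_self_eq_zero.mp (dotProduct_eq_zero_of_mem_span h (hs ▸ Submodule.mem_top))

/-- A proper subspace lies in the kernel of a nonzero functional, and every functional on ℝ^n is a
dot product. -/
theorem span_eq_top_of_dotProduct {n : ℕ} (W : Submodule ℝ (Fin n → ℝ))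
    (h : ∀ Y : Fin n → ℝ, (∀ w ∈ W, w ⬝ᵥ Y = 0) → Y = 0) : W = ⊤ := by
  by_contra hW
  obtain ⟨f, hf, hle⟩ := Submodule.exists_le_ker_of_lt_top W (lt_top_iff_ne_top.mpr hW)
  have hfe : ∀ w, f w = w ⬝ᵥ fun i => f (Pi.single i 1) := by
    intro w
    conv_lhs => rw [pi_eq_sum_univ' w, map_sum]
    simp [dotProduct]
  have h0 := h (fun i => f (Pi.single i 1)) fun w hw => by
    rw [← hfe]; exact hle hw
  apply hf
  ext i
  simpa using congrFun h0 i

theorem span_eq_top_of_single_mem {n : ℕ} (W : Submodule ℝ (Fin n → ℝ))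
    (h : ∀ i, (Pi.single i 1 : Fin n → ℝ) ∈ W) : W = ⊤ := by
  rw [eq_top_iff, ← (Pi.basisFun ℝ (Fin n)).span_eq, Submodule.span_le]
  rintro _ ⟨i, rfl⟩
  simpa using h i

theorem Matrix.abs_det_le_prod {n : ℕ} (A : Matrix (Fin n) (Fin n) ℤ) (b : Fin n → ℝ)
    (h : ∀ k j, |(A k j : ℝ)| ≤ b k) : |(A.det : ℝ)| ≤ n.factorial * ∏ k, b k := by
  rw [Matrix.det_apply']
  push_cast
  refine (Finset.abs_sum_le_sum_abs _ _).trans ?_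
  have : ∀ σ ∈ (Finset.univ : Finset (Equiv.Perm (Fin n))),
      |((Equiv.Perm.sign σ : ℤ) : ℝ) * ∏ i, (A (σ i) i : ℝ)| ≤ ∏ k, b k := by
    intro σ _
    have hs : |((Equiv.Perm.sign σ : ℤ) : ℝ)| = 1 := by
      rcases Int.units_eq_one_or (Equiv.Perm.sign σ) with h | h <;> simp [h]
    rw [abs_mul, hs, one_mul, Finset.abs_prod, ← Equiv.prod_comp σ b]
    exact Finset.prod_le_prod (fun _ _ => abs_nonneg _) fun i _ => h _ _
  refine (Finset.sum_le_card_nsmul _ _ _ this).trans ?_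
  simp [Fintype.card_perm]

/-- If the homogeneous linear system with rows `A`, `B` is degenerate and the rows `A` are
independent, then it has an integral solution bounded as in Cramer's rule. -/
theorem exists_small_solution {n r : ℕ} {κ : Type*} (A : Fin r → Fin n → ℤ) (B : κ → Fin n → ℤ)
    (α β : ℝ) (hβ : 1 ≤ β) (hA : ∀ a j, |(A a j : ℝ)| ≤ α) (hB : ∀ c j, |(B c j : ℝ)| ≤ β)
    (hind : LinearIndependent ℝ (fun a j => (A a j : ℝ)))
    (hex : ∃ Y : Fin n → ℝ, Y ≠ 0 ∧ (∀ a, (fun j => (A a j : ℝ)) ⬝ᵥ Y = 0) ∧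
      ∀ c, (fun j => (B c j : ℝ)) ⬝ᵥ Y = 0) :
    r < n ∧ ∃ Y : Fin n → ℤ, Y ≠ 0 ∧ (∀ a, A a ⬝ᵥ Y = 0) ∧ (∀ c, B c ⬝ᵥ Y = 0) ∧
      ∀ i, |(Y i : ℝ)| ≤ n.factorial * (α ^ r * β ^ (n - 1 - r)) := by
  classical
  obtain ⟨Y, hY0, hYA, hYB⟩ := hex
  let w : Fin r ⊕ κ ⊕ Fin n → Fin n → ℤ :=
    Sum.elim A (Sum.elim B fun i => Pi.single i 1)
  let v : Fin r ⊕ κ ⊕ Fin n → Fin n → ℝ := fun q j => (w q j : ℝ)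
  let t : Set (Fin r ⊕ κ ⊕ Fin n) := {q | v q ⬝ᵥ Y = 0}
  have hs : LinearIndepOn ℝ v (Set.range Sum.inl) := by
    rw [linearIndepOn_range_iff Sum.inl_injective]
    exact hind
  have hst : Set.range Sum.inl ⊆ t := by
    rintro _ ⟨a, rfl⟩
    exact hYA a
  -- The basis is built in two stages: `b₂` contains the rows of `A` and spans all rows orthogonal
  -- to the real solution; `b₃` completes it, if needed by coordinate vectors.
  obtain ⟨b₂, hb₂t, hsb₂, hspan₂, hind₂⟩ := exists_linearIndepOn_extension hs hst
  obtain ⟨b₃, -, hb₂₃, hspan₃, hind₃⟩ := exists_linearIndepOn_extension hind₂ (Set.subset_univ b₂)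
  have htop : Submodule.span ℝ (v '' b₃) = ⊤ := by
    refine span_eq_top_of_single_mem _ fun i => hspan₃ ⟨Sum.inr (Sum.inr i), trivial, ?_⟩
    ext j
    by_cases h : j = i <;> simp [v, w, h]
  obtain ⟨φ, hφinj, hφ, hφind⟩ := exists_injective_of_linearIndepOn v b₃ hind₃ htop
  obtain ⟨k₀, hk₀⟩ : ∃ k₀, φ k₀ ∉ b₂ := by
    by_contra! hall
    refine hY0 (eq_zero_of_dotProduct_eq_zero (s := v '' b₃) ?_ htop)
    rintro _ ⟨q, hq, rfl⟩
    rw [← hφ] at hq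
    obtain ⟨k, rfl⟩ := hq
    exact hb₂t (hall k)
  let W : Matrix (Fin n) (Fin n) ℤ := Matrix.of fun k => w (φ k)
  have hdet : W.det ≠ 0 := by
    have h1 : IsUnit (W.map (Int.cast : ℤ → ℝ)) := by
      rw [← Matrix.linearIndependent_rows_iff_isUnit]
      exact hφind
    have h2 := (Matrix.isUnit_iff_isUnit_det _).mp h1
    have h3 : (W.map (Int.cast : ℤ → ℝ)).det = (W.det : ℝ) := by
      simpa using (Int.castRingHom ℝ).map_det W |>.symm
    rw [h3] at h2
    exact_mod_cast h2.ne_zero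
  -- This adjugate column is orthogonal to every basis row except row `k₀`, hence to the span of
  -- `b₂`, and it pairs with row `k₀` to the nonzero determinant.
  let Z : Fin n → ℤ := fun j => W.adjugate j k₀
  have hZ : ∀ k, w (φ k) ⬝ᵥ Z = W.det * (if k = k₀ then 1 else 0) := by
    intro k
    have := congrFun (congrFun W.mul_adjugate k) k₀
    rw [Matrix.mul_apply, Matrix.smul_apply, Matrix.one_apply, smul_eq_mul] at this
    exact this
  have hZt : ∀ q ∈ t, w q ⬝ᵥ Z = 0 := by
    intro q hq
    have h1 : v q ⬝ᵥ (fun j => (Z j : ℝ)) = 0 := by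
      refine dotProduct_eq_zero_of_mem_span (s := v '' b₂) ?_ (hspan₂ ⟨q, hq, rfl⟩)
      rintro _ ⟨p, hp, rfl⟩
      obtain ⟨k, rfl⟩ : p ∈ Set.range φ := hφ ▸ hb₂₃ hp
      have hk : k ≠ k₀ := by rintro rfl; exact hk₀ hp
      have h2 := hZ k
      simp only [hk, if_false, mul_zero, dotProduct] at h2
      simp only [v, dotProduct]
      exact_mod_cast h2
    simp only [v, dotProduct] at h1 ⊢
    exact_mod_cast h1
  let F : Finset (Fin n) := Finset.univ.filter fun k => (φ k).isLeft
  have hF : F.card = r := by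
    have : F.map ⟨φ, hφinj⟩ = Finset.univ.map ⟨Sum.inl, Sum.inl_injective⟩ := by
      ext q
      simp only [F, Finset.mem_map, Finset.mem_filter, Finset.mem_univ, true_and,
        Function.Embedding.coeFn_mk]
      constructor
      · rintro ⟨k, hk, rfl⟩
        obtain ⟨a, ha⟩ := Sum.isLeft_iff.mp hk
        exact ⟨a, ha.symm⟩
      · rintro ⟨a, rfl⟩
        obtain ⟨k, hk⟩ : (Sum.inl a : Fin r ⊕ κ ⊕ Fin n) ∈ Set.range φ := hφ ▸ hb₂₃ (hsb₂ ⟨a, rfl⟩)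
        exact ⟨k, by simp [hk], hk⟩
    have h2 := congrArg Finset.card this
    simpa using h2
  have hk₀F : k₀ ∉ F := by
    intro hk
    obtain ⟨a, ha⟩ := Sum.isLeft_iff.mp (Finset.mem_filter.mp hk).2
    exact hk₀ (hsb₂ ⟨a, ha.symm⟩)
  have hcardle : (insert k₀ F).card ≤ n := by
    simpa using Finset.card_le_univ (insert k₀ F)
  rw [Finset.card_insert_of_notMem hk₀F, hF] at hcardle
  refine ⟨hcardle, Z, ?_, fun a => hZt (Sum.inl a) (hYA a),
    fun c => hZt (Sum.inr (Sum.inl c)) (hYB c), fun i => ?_⟩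
  · intro h0
    have := hZ k₀
    simp only [h0, dotProduct_zero, if_true, mul_one] at this
    exact hdet this.symm
  -- The entry is a determinant with row `k₀` replaced by a unit vector. Besides it there are `r`
  -- rows of size `α` and n - 1 - r rows of size `β`; coordinate rows fit the latter because 1 ≤ β.
  · let bd : Fin n → ℝ := fun k => if k = k₀ then 1 else if (φ k).isLeft then α else β
    have h1 : |(Z i : ℝ)| ≤ n.factorial * ∏ k, bd k := by
      simp only [Z, Matrix.adjugate_apply]
      refine Matrix.abs_det_le_prod _ bd fun k j => ?_
      by_cases hk : k = k₀
      · subst hk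
        simp only [Matrix.updateRow_self, bd, if_true]
        by_cases h : j = i <;> simp [h]
      · rw [Matrix.updateRow_ne hk]
        simp only [bd, hk, if_false, W, Matrix.of_apply]
        rcases h : φ k with a | c | l
        · simpa [w] using hA a j
        · simpa [w] using hB c j
        · by_cases h : j = l <;> simp [w, h] <;> linarith
    have h2 : ∏ k, bd k = α ^ r * β ^ (n - 1 - r) := by
      rw [← Finset.mul_prod_erase _ _ (Finset.mem_univ k₀)]
      have h3 : ∏ k ∈ Finset.univ.erase k₀, bd k =
          ∏ k ∈ Finset.univ.erase k₀, if k ∈ F then α else β := by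
        refine Finset.prod_congr rfl fun k hk => ?_
        simp [bd, F, Finset.ne_of_mem_erase hk]
      have h4 : (Finset.univ.erase k₀).filter (· ∈ F) = F := by
        ext k
        simp only [Finset.mem_filter, Finset.mem_erase, Finset.mem_univ, and_true]
        exact ⟨fun h => h.2, fun h => ⟨fun h' => hk₀F (h' ▸ h), h⟩⟩
      have h5 : ((Finset.univ.erase k₀).filter (· ∉ F)).card = n - 1 - r := by
        have := Finset.card_filter_add_card_filter_not (s := Finset.univ.erase k₀) (· ∈ F)
        rw [h4, hF, Finset.card_erase_of_mem (Finset.mem_univ _), Finset.card_univ,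
          Fintype.card_fin] at this
        omega
      rw [h3, Finset.prod_ite, h4, Finset.prod_const, Finset.prod_const, hF, h5]
      simp [bd]
    rwa [h2] at h1

/-- If the linear system with `r` rows `A` and rows `B` is nondegenerate, then some rows of `B`
together with at most `r` coordinate vectors form a nondegenerate square system. -/
theorem exists_square_subsystem {n r : ℕ} {κ : Type*} (A : Fin r → Fin n → ℝ) (B : κ → Fin n → ℝ)
    (h : ∀ Y : Fin n → ℝ, (∀ a, A a ⬝ᵥ Y = 0) → (∀ c, B c ⬝ᵥ Y = 0) → Y = 0) :
    ∃ g : Fin n → κ ⊕ Fin n, (Finset.univ.filter fun k => (g k).isRight).card ≤ r ∧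
      ∀ Y : Fin n → ℝ, (∀ k, Sum.elim B (fun i => Pi.single i 1) (g k) ⬝ᵥ Y = 0) → Y = 0 := by
  classical
  let v : κ ⊕ Fin n → Fin n → ℝ := Sum.elim B fun i => Pi.single i 1
  -- Independent rows of `B` are exhausted before any coordinate vector is added. As `A` and `B`
  -- together have rank n, at least n - r rows come from `B`.
  obtain ⟨b₁, hb₁, -, hspan₁, hind₁⟩ := exists_linearIndepOn_extension
    (linearIndepOn_empty ℝ v) (Set.empty_subset (Set.range Sum.inl))
  obtain ⟨b₂, -, hb₁₂, hspan₂, hind₂⟩ := exists_linearIndepOn_extension hind₁ (Set.subset_univ b₁)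
  have htop : Submodule.span ℝ (v '' b₂) = ⊤ :=
    span_eq_top_of_single_mem _ fun i => hspan₂ ⟨Sum.inr i, trivial, rfl⟩
  obtain ⟨g, hginj, hg, hgind⟩ := exists_injective_of_linearIndepOn v b₂ hind₂ htop
  refine ⟨g, ?_, fun Y hY => ?_⟩
  · let F : Finset (Fin n) := Finset.univ.filter fun k => ¬ (g k).isRight
    have hle : Submodule.span ℝ (v '' b₁) ≤
        Submodule.span ℝ ((F.image fun k => v (g k) : Finset (Fin n → ℝ)) : Set (Fin n → ℝ)) := by
      refine Submodule.span_mono ?_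
      rintro _ ⟨q, hq, rfl⟩
      obtain ⟨k, rfl⟩ : q ∈ Set.range g := hg ▸ hb₁₂ hq
      obtain ⟨c, hc⟩ := hb₁ hq
      simp only [Finset.coe_image, Set.mem_image, Finset.mem_coe]
      exact ⟨k, by simp [F, ← hc], rfl⟩
    have hsum : Submodule.span ℝ (Set.range A) ⊔ Submodule.span ℝ
        ((F.image fun k => v (g k) : Finset (Fin n → ℝ)) : Set (Fin n → ℝ)) = ⊤ := by
      refine span_eq_top_of_dotProduct _ fun Y hY => h Y (fun a => ?_) fun c => ?_
      · exact hY _ (Submodule.mem_sup_left (Submodule.subset_span ⟨a, rfl⟩))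
      · exact hY _ (Submodule.mem_sup_right (hle (hspan₁ ⟨Sum.inl c, ⟨c, rfl⟩, rfl⟩)))
    have h1 := Submodule.finrank_add_le_finrank_add_finrank (Submodule.span ℝ (Set.range A))
      (Submodule.span ℝ ((F.image fun k => v (g k) : Finset (Fin n → ℝ)) : Set (Fin n → ℝ)))
    rw [hsum, finrank_top, Module.finrank_fin_fun] at h1
    have h2 : Module.finrank ℝ (Submodule.span ℝ (Set.range A)) ≤ r := by
      simpa [Set.finrank] using finrank_range_le_card (R := ℝ) A
    have h3 := finrank_span_finset_le_card (R := ℝ) (F.image fun k => v (g k))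
    have h4 := Finset.card_image_le (s := F) (f := fun k => v (g k))
    have h5 := Finset.card_filter_add_card_filter_not (s := (Finset.univ : Finset (Fin n)))
      (fun k => ((g k).isRight : Prop))
    rw [Finset.card_univ, Fintype.card_fin] at h5
    change _ + F.card = n at h5
    rw [Set.finrank] at h3
    omega
  · refine eq_zero_of_dotProduct_eq_zero (s := v '' b₂) ?_ htop
    rintro _ ⟨q, hq, rfl⟩
    rw [← hg] at hq
    obtain ⟨k, rfl⟩ := hq
    exact hY k

/-! ### Height bounds for polynomials and their gradients -/

/-- A bound for a polynomial, of degree at most `d`, and its gradient at a point `x` of height `H`. -/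
structure PolyBound {n : ℕ} (x : Fin n → ℤ) (H a : ℝ) (d : ℕ) (p : MvPolynomial (Fin n) ℤ) :
    Prop where
  deg : p.totalDegree ≤ d
  val : |(MvPolynomial.eval x p : ℝ)| ≤ a * H ^ d
  der : ∀ i, H * |(MvPolynomial.eval x (MvPolynomial.pderiv i p) : ℝ)| ≤ d * (a * H ^ d)

namespace PolyBound

variable {n : ℕ} {x : Fin n → ℤ} {H a b : ℝ} {d e : ℕ} {p q : MvPolynomial (Fin n) ℤ}

theorem zero (hH : 0 ≤ H) (ha : 0 ≤ a) : PolyBound x H a d 0 := by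
  refine ⟨by simp, ?_, fun i => ?_⟩ <;> simp <;> positivity

theorem one : PolyBound x H 1 0 1 :=
  ⟨by simp, by simp, fun i => by simp⟩

theorem neg (hp : PolyBound x H a d p) : PolyBound x H a d (-p) :=
  ⟨by simpa using hp.deg, by simpa using hp.val, fun i => by simpa using hp.der i⟩

theorem mono (hH : 0 ≤ H) (hp : PolyBound x H a d p) (hab : a ≤ b) : PolyBound x H b d p := by
  refine ⟨hp.deg, hp.val.trans ?_, fun i => (hp.der i).trans ?_⟩ <;> gcongr

theorem add (hH : 0 ≤ H) (hp : PolyBound x H a d p) (hq : PolyBound x H b d q) :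
    PolyBound x H (a + b) d (p + q) := by
  refine ⟨(MvPolynomial.totalDegree_add _ _).trans (max_le hp.deg hq.deg), ?_, fun i => ?_⟩
  · rw [map_add, Int.cast_add, add_mul]
    exact (abs_add_le _ _).trans (add_le_add hp.val hq.val)
  · rw [map_add, map_add, Int.cast_add]
    calc _ ≤ H * (|(MvPolynomial.eval x (MvPolynomial.pderiv i p) : ℝ)| +
          |(MvPolynomial.eval x (MvPolynomial.pderiv i q) : ℝ)|) := by
            gcongr; exact abs_add_le _ _
      _ ≤ d * (a * H ^ d) + d * (b * H ^ d) := by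
            rw [mul_add]; exact add_le_add (hp.der i) (hq.der i)
      _ = _ := by ring

/-- The factor `d` in the gradient bound is additive under the product rule, so constants simply
multiply. -/
theorem mul (hH : 0 ≤ H) (hp : PolyBound x H a d p) (hq : PolyBound x H b e q) :
    PolyBound x H (a * b) (d + e) (p * q) := by
  have h1 := (abs_nonneg _).trans hp.val
  have h2 := (abs_nonneg _).trans hq.val
  refine ⟨(MvPolynomial.totalDegree_mul _ _).trans (add_le_add hp.deg hq.deg), ?_, fun i => ?_⟩
  · rw [map_mul, Int.cast_mul, abs_mul]
    calc _ ≤ (a * H ^ d) * (b * H ^ e) :=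
          mul_le_mul hp.val hq.val (abs_nonneg _) h1
      _ = _ := by ring
  · rw [MvPolynomial.pderiv_mul, map_add, map_mul, map_mul, Int.cast_add, Int.cast_mul,
      Int.cast_mul]
    set p' := (MvPolynomial.eval x (MvPolynomial.pderiv i p) : ℝ)
    set q' := (MvPolynomial.eval x (MvPolynomial.pderiv i q) : ℝ)
    set p₀ := (MvPolynomial.eval x p : ℝ)
    set q₀ := (MvPolynomial.eval x q : ℝ)
    calc H * |p' * q₀ + p₀ * q'| ≤ H * (|p' * q₀| + |p₀ * q'|) := by
          gcongr; exact abs_add_le _ _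
      _ = (H * |p'|) * |q₀| + |p₀| * (H * |q'|) := by rw [abs_mul, abs_mul]; ring
      _ ≤ (d * (a * H ^ d)) * (b * H ^ e) + (a * H ^ d) * (e * (b * H ^ e)) := by
          refine add_le_add ?_ ?_
          · exact mul_le_mul (hp.der i) hq.val (abs_nonneg _) (by positivity)
          · exact mul_le_mul hp.val (hq.der i) (by positivity) h1
      _ = _ := by push_cast; ring

theorem sum {ι : Type*} (s : Finset ι) (f : ι → MvPolynomial (Fin n) ℤ) (hH : 0 ≤ H)
    (h : ∀ j ∈ s, PolyBound x H a d (f j)) : PolyBound x H (s.card * a) d (∑ j ∈ s, f j) := by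
  classical
  induction s using Finset.induction_on with
  | empty => simpa using zero hH le_rfl
  | insert j s hj ih =>
    rw [Finset.sum_insert hj, Finset.card_insert_of_notMem hj]
    refine ((h j (Finset.mem_insert_self _ _)).add hH
      (ih fun k hk => h k (Finset.mem_insert_of_mem hk))).mono hH ?_
    push_cast; linarith

theorem prod {ι : Type*} (s : Finset ι) (f : ι → MvPolynomial (Fin n) ℤ) (hH : 0 ≤ H)
    (h : ∀ j ∈ s, PolyBound x H a 1 (f j)) : PolyBound x H (a ^ s.card) s.card (∏ j ∈ s, f j) := by
  classical
  induction s using Finset.induction_on with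
  | empty => simpa using one
  | insert j s hj ih =>
    rw [Finset.prod_insert hj, Finset.card_insert_of_notMem hj, add_comm s.card, pow_add, pow_one]
    exact (h j (Finset.mem_insert_self _ _)).mul hH
      (ih fun k hk => h k (Finset.mem_insert_of_mem hk))

theorem det {r : ℕ} (A : Matrix (Fin r) (Fin r) (MvPolynomial (Fin n) ℤ)) (hH : 0 ≤ H)
    (h : ∀ j k, PolyBound x H a 1 (A j k)) : PolyBound x H (r.factorial * a ^ r) r A.det := by
  rw [Matrix.det_apply']
  have hs : ∀ σ ∈ (Finset.univ : Finset (Equiv.Perm (Fin r))),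
      PolyBound x H (a ^ r) r (((Equiv.Perm.sign σ : ℤ) : MvPolynomial (Fin n) ℤ) *
        ∏ i, A (σ i) i) := by
    intro σ _
    have := prod Finset.univ (fun i => A (σ i) i) hH fun i _ => h _ _
    rw [Finset.card_univ, Fintype.card_fin] at this
    rcases Int.units_eq_one_or (Equiv.Perm.sign σ) with h | h
    · simpa [h] using this
    · simpa [h] using this.neg
  simpa [Fintype.card_perm] using sum _ _ hH hs

end PolyBound

/-! ### The kernel matrix and principal minors -/

/-- The matrix `det(S_ee) - E adj(S_ee) S_e`, whose columns are killed by the rows `e` of `S`. -/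
noncomputable def kernelMatrix {R : Type*} [CommRing R] {n r : ℕ} (S : Matrix (Fin n) (Fin n) R)
    (e : Fin r → Fin n) : Matrix (Fin n) (Fin n) R :=
  (S.submatrix e e).det • 1 -
    (1 : Matrix (Fin n) (Fin n) R).submatrix id e * ((S.submatrix e e).adjugate * S.submatrix e id)

theorem submatrix_mul_kernelMatrix {R : Type*} [CommRing R] {n r : ℕ}
    (S : Matrix (Fin n) (Fin n) R) (e : Fin r → Fin n) :
    S.submatrix e id * kernelMatrix S e = 0 := by
  have h : S.submatrix e id * (1 : Matrix (Fin n) (Fin n) R).submatrix id e = S.submatrix e e := by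
    ext a b
    simp [Matrix.mul_apply, Matrix.one_apply]
  rw [kernelMatrix, Matrix.mul_sub, ← Matrix.mul_assoc, h, ← Matrix.mul_assoc, Matrix.mul_adjugate]
  simp

/-- The subtracted term factors through the rows `e` of S, which kill Y, so only the scalar term
survives. -/
theorem kernelMatrix_mulVec {R : Type*} [CommRing R] {n r : ℕ}
    (S : Matrix (Fin n) (Fin n) R) (e : Fin r → Fin n) (Y : Fin n → R)
    (hY : S.submatrix e id *ᵥ Y = 0) :
    kernelMatrix S e *ᵥ Y = (S.submatrix e e).det • Y := by
  rw [kernelMatrix, Matrix.sub_mulVec, ← Matrix.mulVec_mulVec, ← Matrix.mulVec_mulVec, hY]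
  simp [Matrix.smul_mulVec]

theorem kernelMatrix_map {R R' : Type*} [CommRing R] [CommRing R'] (f : R →+* R') {n r : ℕ}
    (S : Matrix (Fin n) (Fin n) R) (e : Fin r → Fin n) :
    (kernelMatrix S e).map f = kernelMatrix (S.map f) e := by
  have hdet : f (S.submatrix e e).det = ((S.map f).submatrix e e).det := by
    rw [RingHom.map_det]; rfl
  have hadj : (S.submatrix e e).adjugate.map f = ((S.map f).submatrix e e).adjugate :=
    RingHom.map_adjugate f _
  have hone : ((1 : Matrix (Fin n) (Fin n) R).submatrix id e).map f =
      (1 : Matrix (Fin n) (Fin n) R').submatrix id e := by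
    ext a b
    simp [Matrix.one_apply, apply_ite f]
  rw [kernelMatrix, kernelMatrix, Matrix.map_sub f (map_sub f), Matrix.map_mul, Matrix.map_mul,
    hadj, hone, ← hdet]
  congr 1
  ext a b
  simp [Matrix.one_apply, apply_ite f]

theorem PolyBound.kernelMatrix_apply {n r : ℕ} {x : Fin n → ℤ} {H a : ℝ} (hH : 0 ≤ H) (ha : 0 ≤ a)
    (S : Matrix (Fin n) (Fin n) (MvPolynomial (Fin n) ℤ)) (e : Fin r → Fin n)
    (h : ∀ j k, PolyBound x H a 1 (S j k)) (j l : Fin n) :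
    PolyBound x H ((r + 1) * (r.factorial * a ^ r)) r (kernelMatrix S e j l) := by
  have h0 : 0 ≤ (r.factorial : ℝ) * a ^ r := by positivity
  have h1 : PolyBound x H (r.factorial * a ^ r) r
      (((S.submatrix e e).det • (1 : Matrix (Fin n) (Fin n) (MvPolynomial (Fin n) ℤ))) j l) := by
    rw [Matrix.smul_apply, Matrix.one_apply]
    split_ifs
    · rw [smul_eq_mul, mul_one]
      exact PolyBound.det _ hH fun _ _ => h _ _
    · simpa using PolyBound.zero hH h0
  have h2 : ∀ b, PolyBound x H (r.factorial * a ^ r) r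
      (((S.submatrix e e).adjugate * S.submatrix e id) b l) := by
    intro b
    -- By Cramer's rule this entry is itself an r × r determinant of entries of S.
    have : ((S.submatrix e e).adjugate * S.submatrix e id) b l =
        ((S.submatrix e e).updateCol b fun c => S (e c) l).det := by
      rw [← Matrix.cramer_apply, Matrix.cramer_eq_adjugate_mulVec]
      rfl
    rw [this]
    refine PolyBound.det _ hH fun c k => ?_
    rw [Matrix.updateCol_apply]
    split_ifs <;> exact h _ _
  have h3 : PolyBound x H (r * (r.factorial * a ^ r)) r
      (((1 : Matrix (Fin n) (Fin n) (MvPolynomial (Fin n) ℤ)).submatrix id e *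
        ((S.submatrix e e).adjugate * S.submatrix e id)) j l) := by
    rw [Matrix.mul_apply]
    have := PolyBound.sum (x := x) (H := H) (a := r.factorial * a ^ r) (d := r) Finset.univ
      (fun b => ((1 : Matrix (Fin n) (Fin n) (MvPolynomial (Fin n) ℤ)).submatrix id e) j b *
        ((S.submatrix e e).adjugate * S.submatrix e id) b l) hH fun b _ => by
      rw [Matrix.submatrix_apply, Matrix.one_apply]
      split_ifs
      · simpa using h2 b
      · simpa using PolyBound.zero hH h0
    simpa using this
  rw [kernelMatrix, Matrix.sub_apply, sub_eq_add_neg]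
  refine (h1.add hH h3.neg).mono hH (le_of_eq ?_)
  ring

/-- A symmetric matrix of rank `r` has a nonzero principal `r`-minor whose rows span the row
space. -/
theorem exists_principal_minor {K : Type*} [Field K] {n r : ℕ} (S : Matrix (Fin n) (Fin n) K)
    (hS : S.transpose = S) (hr : S.rank = r) :
    ∃ e : Fin r → Fin n, (S.submatrix e e).det ≠ 0 ∧
      ∃ A : Matrix (Fin n) (Fin r) K, S = A * S.submatrix e id := by
  obtain ⟨κ, a, ha, hspan, hind⟩ := exists_linearIndependent' K S.row
  have : Finite κ := Finite.of_injective a ha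
  have := Fintype.ofFinite κ
  have hcard : Fintype.card κ = r := by
    rw [← hr, Matrix.rank_eq_finrank_span_row, ← hspan]
    exact (finrank_span_eq_card hind).symm
  let f : Fin r ≃ κ := (Fintype.equivFinOfCardEq hcard).symm
  let e : Fin r → Fin n := fun i => a (f i)
  have hinde : LinearIndependent K (S.submatrix e id).row := hind.comp f f.injective
  have hspane : Submodule.span K (Set.range (S.submatrix e id).row) =
      Submodule.span K (Set.range S.row) := by
    rw [← hspan]
    congr 1
    exact f.surjective.range_comp (S.row ∘ a)
  have hA : ∀ j, ∃ c : Fin r → K, ∑ b, c b • (S.submatrix e id).row b = S.row j := by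
    intro j
    rw [← Submodule.mem_span_range_iff_exists_fun, hspane]
    exact Submodule.subset_span ⟨j, rfl⟩
  choose A hA using hA
  have hSA : S = Matrix.of A * S.submatrix e id := by
    ext j k
    have := congrFun (hA j) k
    simpa [Matrix.mul_apply] using this.symm
  refine ⟨e, fun hdet => ?_, Matrix.of A, hSA⟩
  obtain ⟨v, hv, hv0⟩ := Matrix.exists_vecMul_eq_zero_iff.mpr hdet
  -- By symmetry the columns `e` also span the column space, so a left null vector of the principal
  -- block kills the whole rows `e`, contradicting their independence.
  have h1 : S.submatrix e id = S.submatrix e e * (Matrix.of A).transpose := by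
    have h2 : S = (S.submatrix e id).transpose * (Matrix.of A).transpose := by
      rw [← Matrix.transpose_mul, ← hSA, hS]
    ext b k
    have h3 := congrFun (congrFun h2 (e b)) k
    have hsym : ∀ i j, S i j = S j i := fun i j => congrFun (congrFun hS j) i
    simp only [Matrix.submatrix_apply, id]
    rw [h3]
    simp only [Matrix.mul_apply, Matrix.transpose_apply, Matrix.submatrix_apply, id]
    exact Finset.sum_congr rfl fun c _ => by rw [hsym]
  have h2 : v ᵥ* S.submatrix e id = 0 := by
    rw [h1, ← Matrix.vecMul_vecMul, hv0, Matrix.zero_vecMul]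
  exact hv (Matrix.vecMul_injective_iff.mpr hinde (by simpa using h2))

/-! ### The Hessian, its bordered minors, and tangent vectors -/

/-- The Hessian matrix of `C`, which is `6 M(x)` with polynomial entries. -/
noncomputable def hessian {n : ℕ} (C : MvPolynomial (Fin n) ℤ) :
    Matrix (Fin n) (Fin n) (MvPolynomial (Fin n) ℤ) :=
  Matrix.of fun j k => MvPolynomial.pderiv j (MvPolynomial.pderiv k C)

theorem hessian_transpose {n : ℕ} (C : MvPolynomial (Fin n) ℤ) :
    (hessian C).transpose = hessian C := by
  ext1 j k
  exact pderiv_comm_aux k j C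

theorem MvPolynomial.IsHomogeneous.eval_eq_constantCoeff {n : ℕ} {F : MvPolynomial (Fin n) ℤ}
    (hF : F.IsHomogeneous 0) (x : Fin n → ℤ) :
    MvPolynomial.eval x F = MvPolynomial.constantCoeff F := by
  rw [MvPolynomial.totalDegree_eq_zero_iff_eq_C.mp
    ((MvPolynomial.totalDegree_zero_iff_isHomogeneous _).mpr hF)]
  simp

theorem MvPolynomial.IsHomogeneous.eval_eq_sum_constantCoeff_pderiv {n : ℕ}
    {F : MvPolynomial (Fin n) ℤ} (hF : F.IsHomogeneous 1) (x : Fin n → ℤ) :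
    MvPolynomial.eval x F =
      ∑ i, x i * MvPolynomial.constantCoeff (MvPolynomial.pderiv i F) := by
  have h := congrArg (MvPolynomial.eval x) hF.sum_X_mul_pderiv
  simp only [map_sum, map_mul, MvPolynomial.eval_X, one_smul] at h
  rw [← h]
  exact Finset.sum_congr rfl fun i _ => by
    rw [(hF.pderiv (i := i)).eval_eq_constantCoeff]

section

variable {n : ℕ} {C : MvPolynomial (Fin n) ℤ}

theorem hessian_isHomogeneous (hC : C.IsHomogeneous 3) (j k : Fin n) :
    (hessian C j k).IsHomogeneous 1 :=
  hC.pderiv.pderiv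

theorem eval_pderiv_hessian (hC : C.IsHomogeneous 3) (x : Fin n → ℤ) (i j k : Fin n) :
    MvPolynomial.eval x (MvPolynomial.pderiv i (hessian C j k)) =
      MvPolynomial.constantCoeff (MvPolynomial.pderiv i (hessian C j k)) :=
  (hessian_isHomogeneous hC j k).pderiv.eval_eq_constantCoeff x

theorem eval_hessian (hC : C.IsHomogeneous 3) (x : Fin n → ℤ) (j k : Fin n) :
    MvPolynomial.eval x (hessian C j k) =
      ∑ i, x i * MvPolynomial.constantCoeff (MvPolynomial.pderiv i (hessian C j k)) :=
  (hessian_isHomogeneous hC j k).eval_eq_sum_constantCoeff_pderiv x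

theorem hessian_map_eval_eq (hC : C.IsHomogeneous 3) (x : Fin n → ℤ) :
    ((hessian C).map (MvPolynomial.eval x)).map (Int.cast : ℤ → ℚ) =
      (6 : ℚ) • cubicMatrix C x := by
  ext j k
  simp only [Matrix.map_apply, Matrix.smul_apply, cubicMatrix, Matrix.of_apply, symCoeff,
    eval_hessian hC, smul_eq_mul]
  push_cast
  rw [Finset.mul_sum]
  refine Finset.sum_congr rfl fun i _ => ?_
  simp only [hessian, Matrix.of_apply]
  ring

theorem rank_hessian (hC : C.IsHomogeneous 3) (x : Fin n → ℤ) :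
    (((hessian C).map (MvPolynomial.eval x)).map (Int.cast : ℤ → ℚ)).rank =
      (cubicMatrix C x).rank := by
  rw [hessian_map_eval_eq hC]
  exact Matrix.rank_smul_of_mem_nonZeroDivisors _ (mem_nonZeroDivisors_of_ne_zero (by norm_num))

/-- Both sides are the symmetric trilinear form of third derivatives evaluated at (Y, Y, Y). -/
theorem six_mul_eval (hC : C.IsHomogeneous 3) (Y : Fin n → ℤ) :
    6 * MvPolynomial.eval Y C = Y ⬝ᵥ ((hessian C).map (MvPolynomial.eval Y) *ᵥ Y) := by
  have h := eval_eq_sum_symCoeff hC Y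
  have h1 : ((6 * MvPolynomial.eval Y C : ℤ) : ℚ) =
      ((Y ⬝ᵥ ((hessian C).map (MvPolynomial.eval Y) *ᵥ Y) : ℤ) : ℚ) := by
    simp only [dotProduct, Matrix.mulVec, Matrix.map_apply, eval_hessian hC]
    push_cast
    rw [h]
    simp only [Finset.mul_sum, Finset.sum_mul]
    rw [Finset.sum_comm]
    refine Finset.sum_congr rfl fun j _ => ?_
    rw [Finset.sum_comm]
    refine Finset.sum_congr rfl fun k _ => Finset.sum_congr rfl fun i _ => ?_
    simp only [symCoeff, hessian, Matrix.of_apply]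
    ring
  exact_mod_cast h1

theorem natAbs_coeff_le_cubicHeight (m : Fin n →₀ ℕ) : (C.coeff m).natAbs ≤ cubicHeight C := by
  by_cases h : m ∈ C.support
  · exact Finset.le_sup (f := fun m => (C.coeff m).natAbs) h
  · simp [MvPolynomial.notMem_support_iff.mp h]

/-- Only the monomial x_i x_j x_k contributes, multiplied by the factorials of its exponents, which
is at most 3! = 6. -/
theorem abs_constantCoeff_pderiv_hessian_le (i j k : Fin n) :
    |((MvPolynomial.constantCoeff (MvPolynomial.pderiv i (hessian C j k)) : ℤ) : ℝ)| ≤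
      6 * cubicHeight C := by
  obtain ⟨w, hw, h⟩ : ∃ w : ℕ, w ≤ 6 ∧
      MvPolynomial.constantCoeff (MvPolynomial.pderiv i (hessian C j k)) =
        C.coeff (Finsupp.single i 1 + Finsupp.single j 1 + Finsupp.single k 1) * w := by
    have hs : ∀ a b : Fin n, (Finsupp.single a 1 : Fin n →₀ ℕ) b ≤ 1 := by
      intro a b
      rw [Finsupp.single_apply]
      split_ifs <;> omega
    refine ⟨((Finsupp.single i 1 + Finsupp.single j 1 : Fin n →₀ ℕ) k + 1) *
      ((Finsupp.single i 1 : Fin n →₀ ℕ) j + 1), ?_, ?_⟩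
    · refine le_trans (Nat.mul_le_mul (?_ : _ ≤ 3) (?_ : _ ≤ 2)) le_rfl
      · rw [Finsupp.add_apply]
        have h1 := hs i k
        have h2 := hs j k
        omega
      · have h1 := hs i j
        omega
    · rw [MvPolynomial.constantCoeff_eq, MvPolynomial.coeff_pderiv]
      simp only [hessian, Matrix.of_apply, MvPolynomial.coeff_pderiv]
      push_cast
      simp
      ring
  have hc : |((C.coeff (Finsupp.single i 1 + Finsupp.single j 1 + Finsupp.single k 1) : ℤ) : ℝ)| ≤
      cubicHeight C := by
    have := natAbs_coeff_le_cubicHeight (C := C)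
      (Finsupp.single i 1 + Finsupp.single j 1 + Finsupp.single k 1)
    rw [← Int.cast_abs, Int.abs_eq_natAbs]
    exact_mod_cast this
  rw [h, mul_comm (6 : ℝ)]
  push_cast
  rw [abs_mul, Nat.abs_cast]
  exact mul_le_mul hc (by exact_mod_cast hw) (by positivity) (by positivity)

theorem PolyBound.hessian (hC : C.IsHomogeneous 3) {x : Fin n → ℤ} {H : ℝ} (hH : 0 ≤ H)
    (hx : ∀ i, |(x i : ℝ)| ≤ H) (j k : Fin n) :
    PolyBound x H (6 * n * cubicHeight C) 1 (_root_.hessian C j k) := by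
  have hb := fun i => abs_constantCoeff_pderiv_hessian_le (C := C) i j k
  refine ⟨(hessian_isHomogeneous hC j k).totalDegree_le, ?_, fun i => ?_⟩
  · rw [eval_hessian hC]
    push_cast
    refine (Finset.abs_sum_le_sum_abs _ _).trans ?_
    have : ∀ i ∈ (Finset.univ : Finset (Fin n)), |(x i : ℝ) *
        (MvPolynomial.constantCoeff (MvPolynomial.pderiv i (_root_.hessian C j k)) : ℤ)| ≤
          H * (6 * cubicHeight C) := by
      intro i _
      rw [abs_mul]
      exact mul_le_mul (hx i) (hb i) (abs_nonneg _) hH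
    refine (Finset.sum_le_card_nsmul _ _ _ this).trans (le_of_eq ?_)
    simp
    ring
  · rw [eval_pderiv_hessian hC]
    have hn : (1 : ℝ) ≤ n := by exact_mod_cast (Fin.pos i)
    have h0 : (0 : ℝ) ≤ H * (6 * cubicHeight C) := by positivity
    calc _ ≤ H * (6 * (cubicHeight C : ℝ)) := by gcongr; exact hb i
      _ ≤ n * (H * (6 * cubicHeight C)) := le_mul_of_one_le_left h0 hn
      _ = _ := by push_cast; ring

/-- The bordered minors of the Hessian attached to the rows `e`. -/
noncomputable def borderedMinors {r : ℕ} (C : MvPolynomial (Fin n) ℤ) (e : Fin r → Fin n) :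
    Matrix (Fin n) (Fin n) (MvPolynomial (Fin n) ℤ) :=
  hessian C * kernelMatrix (hessian C) e

theorem PolyBound.borderedMinors (hC : C.IsHomogeneous 3) {x : Fin n → ℤ} {H : ℝ} (hH : 0 ≤ H)
    (hx : ∀ i, |(x i : ℝ)| ≤ H) {r : ℕ} (e : Fin r → Fin n) (k l : Fin n) :
    PolyBound x H (n * ((r + 1) * r.factorial * (6 * n * cubicHeight C) ^ (r + 1))) (r + 1)
      (_root_.borderedMinors C e k l) := by
  rw [_root_.borderedMinors, Matrix.mul_apply]
  have := PolyBound.sum (x := x) (H := H)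
    (a := (6 * n * cubicHeight C) * ((r + 1) * (r.factorial * (6 * n * cubicHeight C) ^ r)))
    (d := 1 + r) Finset.univ
    (fun j => _root_.hessian C k j * kernelMatrix (_root_.hessian C) e j l) hH fun j _ =>
      (PolyBound.hessian hC hH hx k j).mul hH
        (PolyBound.kernelMatrix_apply hH (by positivity) _ e (PolyBound.hessian hC hH hx) j l)
  rw [add_comm r 1]
  refine this.mono hH (le_of_eq ?_)
  rw [Finset.card_univ, Fintype.card_fin]
  ring

theorem borderedMinors_map_eval {r : ℕ} (x : Fin n → ℤ) (e : Fin r → Fin n) :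
    (borderedMinors C e).map (MvPolynomial.eval x) =
      (hessian C).map (MvPolynomial.eval x) *
        kernelMatrix ((hessian C).map (MvPolynomial.eval x)) e := by
  rw [borderedMinors, Matrix.map_mul, kernelMatrix_map]

/-- At rank `r` the rows `e` of a nonzero principal minor generate all rows, so the kernel matrix,
annihilated by those rows, is annihilated by all of S. -/
theorem exists_minor_of_rank (hC : C.IsHomogeneous 3) (x : Fin n → ℤ) {r : ℕ}
    (hr : (cubicMatrix C x).rank = r) :
    ∃ e : Fin r → Fin n,
      (((hessian C).map (MvPolynomial.eval x)).submatrix e e).det ≠ 0 ∧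
        (borderedMinors C e).map (MvPolynomial.eval x) = 0 := by
  let S := (hessian C).map (MvPolynomial.eval x)
  have hS : S.transpose = S := by
    rw [← Matrix.transpose_map, hessian_transpose]
  have hSQ : (S.map (Int.castRingHom ℚ)).transpose = S.map (Int.castRingHom ℚ) := by
    rw [← Matrix.transpose_map, hS]
  obtain ⟨e, hdet, A, hA⟩ := exists_principal_minor (r := r) (S.map (Int.castRingHom ℚ)) hSQ
    (by rw [← hr, ← rank_hessian hC x]; rfl)
  refine ⟨e, fun h0 => hdet ?_, ?_⟩
  · have h1 : (S.map (Int.castRingHom ℚ)).submatrix e e =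
      (Int.castRingHom ℚ).mapMatrix (S.submatrix e e) := rfl
    rw [h1, ← RingHom.map_det, h0, map_zero]
  · rw [borderedMinors_map_eval]
    have h1 : (S * kernelMatrix S e).map (Int.castRingHom ℚ) = 0 := by
      rw [Matrix.map_mul, kernelMatrix_map]
      conv_lhs => enter [1]; rw [hA]
      rw [Matrix.mul_assoc, submatrix_mul_kernelMatrix, Matrix.mul_zero]
    ext j k
    have := congrFun (congrFun h1 j) k
    simpa using this

/-- A common vector of the kernel of `M(x)` and of the tangent space of the rank locus is a zero. -/
theorem eval_eq_zero_of_tangent (hC : C.IsHomogeneous 3) {x Y : Fin n → ℤ} {r : ℕ}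
    {e : Fin r → Fin n} (hdet : (((hessian C).map (MvPolynomial.eval x)).submatrix e e).det ≠ 0)
    (h0 : (borderedMinors C e).map (MvPolynomial.eval x) = 0)
    (hker : ((hessian C).map (MvPolynomial.eval x)).submatrix e id *ᵥ Y = 0)
    (htan : ∀ k l, (fun i => MvPolynomial.eval x
      (MvPolynomial.pderiv i (borderedMinors C e k l))) ⬝ᵥ Y = 0) :
    MvPolynomial.eval Y C = 0 := by
  set S := (hessian C).map (MvPolynomial.eval x) with hSdef
  let P := kernelMatrix S e
  have hS : S.transpose = S := by
    rw [← Matrix.transpose_map, hessian_transpose]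
  have hSP : S * P = 0 := by rw [← h0, borderedMinors_map_eval]
  -- `Q` is the derivative of the kernel matrix along Y. The matching derivative of the Hessian is
  -- `T`, its value at Y, because its entries are linear.
  let Q : Matrix (Fin n) (Fin n) ℤ := Matrix.of fun j l =>
    ∑ i, MvPolynomial.eval x (MvPolynomial.pderiv i (kernelMatrix (hessian C) e j l)) * Y i
  let T := (hessian C).map (MvPolynomial.eval Y)
  have hP : ∀ j l, MvPolynomial.eval x (kernelMatrix (hessian C) e j l) = P j l := fun j l =>
    congrFun (congrFun (kernelMatrix_map (MvPolynomial.eval x) (hessian C) e) j) l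
  have hV : T * P + S * Q = 0 := by
    ext k l
    rw [Matrix.zero_apply, ← htan k l]
    simp only [Matrix.add_apply, Matrix.mul_apply, dotProduct, borderedMinors, map_sum,
      MvPolynomial.pderiv_mul, map_add, map_mul, hP]
    simp only [T, Q, S, Matrix.of_apply, Matrix.map_apply, eval_hessian hC Y,
      eval_pderiv_hessian hC x, Finset.mul_sum, Finset.sum_mul]
    rw [Finset.sum_comm, Finset.sum_comm (s := Finset.univ) (t := Finset.univ)
      (f := fun j i => MvPolynomial.eval x (hessian C k j) * _)]
    rw [← Finset.sum_add_distrib]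
    refine Finset.sum_congr rfl fun i _ => ?_
    rw [← Finset.sum_add_distrib]
    exact Finset.sum_congr rfl fun j _ => by ring
  have hPS : P.transpose * S = 0 := by
    rw [← hS, ← Matrix.transpose_mul, hSP, Matrix.transpose_zero]
  -- Multiplying by Pᵀ eliminates the unknown derivative `Q`, since PᵀS = 0 by symmetry.
  have hPTP : P.transpose * (T * P) = 0 := by
    have h1 := congrArg (P.transpose * ·) hV
    simp only [Matrix.mul_add, Matrix.mul_zero] at h1
    rw [← Matrix.mul_assoc P.transpose S, hPS, Matrix.zero_mul, add_zero] at h1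
    exact h1
  have hPY : P *ᵥ Y = (S.submatrix e e).det • Y := kernelMatrix_mulVec S e Y hker
  have h2 : (P *ᵥ Y) ⬝ᵥ (T *ᵥ (P *ᵥ Y)) = 0 := by
    have h3 : Y ⬝ᵥ ((P.transpose * (T * P)) *ᵥ Y) = 0 := by
      rw [hPTP]; simp
    rwa [← Matrix.mulVec_mulVec, ← Matrix.mulVec_mulVec, Matrix.dotProduct_mulVec,
      Matrix.vecMul_transpose] at h3
  rw [hPY, Matrix.mulVec_smul, smul_dotProduct, dotProduct_smul, ← six_mul_eval hC] at h2
  simpa [hdet] using h2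

end

/-! ### Counting points of given rank -/

/-- Counting integer points satisfying part of a square system whose remaining equations are
coordinate equations. -/
theorem card_le_of_nondegenerate {n r D : ℕ} (hD : 1 < D) {κ : Type*}
    (h : κ → MvPolynomial (Fin n) ℤ) (hdeg : ∀ c, (h c).totalDegree < D) (g : Fin n → κ ⊕ Fin n)
    (hg : (Finset.univ.filter fun k => (g k).isRight).card ≤ r) {H : ℝ} (hH : 1 ≤ H)
    (S : Finset (Fin n → ℤ)) (hS : ∀ x ∈ S, ∀ i, |(x i : ℝ)| ≤ H)
    (hzero : ∀ x ∈ S, ∀ c, MvPolynomial.eval x (h c) = 0)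
    (hnd : ∀ x ∈ S, ∀ Y : Fin n → ℝ, (∀ k, Sum.elim
      (fun c i => (MvPolynomial.eval x (MvPolynomial.pderiv i (h c)) : ℝ))
      (fun i => Pi.single i 1) (g k) ⬝ᵥ Y = 0) → Y = 0) :
    (S.card : ℝ) ≤ D ^ n * (3 * H) ^ r := by
  classical
  -- `φ` records the coordinates selected by `g`. On a fibre these become linear equations,
  -- completing the square system to which the Bézout bound applies.
  let φ : (Fin n → ℤ) → Fin n → ℤ := fun x k => Sum.elim (fun _ => 0) x (g k)
  have hfib : ∀ y ∈ S.image φ, (S.filter fun x => φ x = y).card ≤ D ^ n := by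
    intro y _
    let f : Fin n → MvPolynomial (Fin n) ℝ := fun k => Sum.elim
      (fun c => MvPolynomial.map (Int.castRingHom ℝ) (h c))
      (fun i => MvPolynomial.X i - MvPolynomial.C (y k : ℝ)) (g k)
    let ψ : (Fin n → ℤ) ↪ (Fin n → ℝ) := ⟨fun x i => (x i : ℝ), fun x x' hx => by
      ext i
      exact Int.cast_injective (congrFun hx i)⟩
    have hmap : ∀ (x : Fin n → ℤ) (p : MvPolynomial (Fin n) ℤ),
        MvPolynomial.eval (ψ x) (MvPolynomial.map (Int.castRingHom ℝ) p) =
          (MvPolynomial.eval x p : ℝ) := by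
      intro x p
      rw [MvPolynomial.eval_map]
      exact (MvPolynomial.eval₂_comp (Int.castRingHom ℝ) x p).symm
    have := card_nondegenerate_zeros_le f D ?_ ((S.filter fun x => φ x = y).map ψ) ?_ ?_
    · simpa using this
    · intro k
      rcases hk : g k with c | i
      · simp only [f, hk, Sum.elim_inl]
        exact (Finset.sup_mono (MvPolynomial.support_map_subset _ _)).trans_lt (hdeg c)
      · simp only [f, hk, Sum.elim_inr]
        refine (MvPolynomial.totalDegree_sub_C_le _ _).trans_lt ?_
        rwa [MvPolynomial.totalDegree_X]
    · intro z hz k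
      obtain ⟨x, hx, rfl⟩ := Finset.mem_map.mp hz
      obtain ⟨hxS, hxy⟩ := Finset.mem_filter.mp hx
      rcases hk : g k with c | i
      · simp [f, hk, hmap, hzero x hxS c]
      · have := congrFun hxy k
        simp only [φ, hk, Sum.elim_inr] at this
        have hψ : ψ x i = (x i : ℝ) := rfl
        simp [f, hk, hψ, this]
    · intro z hz Y hY
      obtain ⟨x, hx, rfl⟩ := Finset.mem_map.mp hz
      obtain ⟨hxS, hxy⟩ := Finset.mem_filter.mp hx
      refine hnd x hxS Y fun k => ?_
      have h1 := hY k
      rcases hk : g k with c | i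
      · simpa [f, hk, MvPolynomial.pderiv_map, hmap, dotProduct] using h1
      · simpa [f, hk, MvPolynomial.pderiv_X, Pi.single_apply, apply_ite] using h1
  have h1 := Finset.card_le_mul_card_image S (D ^ n) hfib
  have himg : S.image φ ⊆ Fintype.piFinset fun k =>
      if (g k).isRight then Finset.Icc (-⌊H⌋) ⌊H⌋ else {0} := by
    intro y hy
    obtain ⟨x, hx, rfl⟩ := Finset.mem_image.mp hy
    rw [Fintype.mem_piFinset]
    intro k
    rcases hk : g k with c | i
    · simp [φ, hk]
    · have h2 := abs_le.mp (hS x hx i)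
      simp only [φ, hk, Sum.elim_inr, Sum.isRight_inr, if_true, Finset.mem_Icc]
      refine ⟨?_, Int.le_floor.mpr h2.2⟩
      have : -x i ≤ ⌊H⌋ := Int.le_floor.mpr (by push_cast; linarith)
      omega
  have h2 := Finset.card_le_card himg
  rw [Fintype.card_piFinset] at h2
  have h3 : ((∏ k, (if (g k).isRight then Finset.Icc (-⌊H⌋) ⌊H⌋ else {0}).card : ℕ) : ℝ) ≤
      (3 * H) ^ r := by
    have h4 : ∀ k, (if (g k).isRight then Finset.Icc (-⌊H⌋) ⌊H⌋ else {0}).card =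
        if (g k).isRight then (2 * ⌊H⌋ + 1).toNat else 1 := by
      intro k
      split_ifs
      · rw [Int.card_Icc]; congr 1; ring
      · simp
    simp only [h4]
    rw [← Finset.prod_filter, Finset.prod_const]
    push_cast
    have h5 : (((2 * ⌊H⌋ + 1).toNat : ℕ) : ℝ) ≤ 3 * H := by
      have h6 : (0 : ℤ) ≤ 2 * ⌊H⌋ + 1 := by
        have : (0 : ℤ) ≤ ⌊H⌋ := Int.floor_nonneg.mpr (by linarith)
        omega
      have h7 : (((2 * ⌊H⌋ + 1).toNat : ℤ) : ℝ) = ((2 * ⌊H⌋ + 1 : ℤ) : ℝ) := by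
        rw [Int.toNat_of_nonneg h6]
      rw [Int.cast_natCast] at h7
      rw [h7]
      push_cast
      linarith [Int.floor_le H]
    calc _ ≤ (3 * H) ^ (Finset.univ.filter fun k => ((g k).isRight : Prop)).card := by gcongr
      _ ≤ _ := pow_le_pow_right₀ (by linarith) hg
  calc (S.card : ℝ) ≤ ((D ^ n * (S.image φ).card : ℕ) : ℝ) := by exact_mod_cast h1
    _ = D ^ n * ((S.image φ).card : ℝ) := by push_cast; ring
    _ ≤ _ := by
      gcongr
      exact le_trans (by exact_mod_cast h2) h3

theorem rankCount_le_of_forall_finset {n r : ℕ} {C : MvPolynomial (Fin n) ℤ} {H B : ℝ}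
    (hH : 0 ≤ H) (h : ∀ S : Finset (Fin n → ℤ),
      (∀ x ∈ S, (∀ i, |(x i : ℝ)| ≤ H) ∧ (cubicMatrix C x).rank = r) → (S.card : ℝ) ≤ B) :
    (rankCount C r H : ℝ) ≤ B := by
  have hmem : ∀ x : Fin n → ℤ, ‖x‖ ≤ H → ∀ i, |(x i : ℝ)| ≤ H := fun x hx i => by
    simpa [Int.norm_eq_abs] using (pi_norm_le_iff_of_nonneg hH).mp hx i
  have hfin : {x : Fin n → ℤ | ‖x‖ ≤ H ∧ (cubicMatrix C x).rank = r}.Finite := by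
    refine (Set.finite_Icc (fun _ => -⌊H⌋) (fun _ => ⌊H⌋ : Fin n → ℤ)).subset fun x hx => ?_
    have h1 := fun i => abs_le.mp (hmem x hx.1 i)
    refine ⟨fun i => ?_, fun i => Int.le_floor.mpr (h1 i).2⟩
    have : -x i ≤ ⌊H⌋ := Int.le_floor.mpr (by push_cast; linarith [(h1 i).1])
    change -⌊H⌋ ≤ x i
    omega
  rw [rankCount, Set.ncard_eq_toFinset_card _ hfin]
  exact h _ fun x hx => by
    have := hfin.mem_toFinset.mp hx
    exact ⟨hmem x this.1, this.2⟩

/-- Either the number of points of rank `r` is as small as expected, or the form has a small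
zero. -/
theorem rankCount_le_or_exists_zero (n r : ℕ) (hn : 1 ≤ n) :
    ∃ K L : ℝ, 0 ≤ K ∧ 0 ≤ L ∧ ∀ C : MvPolynomial (Fin n) ℤ, C.IsHomogeneous 3 →
      1 ≤ cubicHeight C → ∀ H : ℝ, 1 ≤ H → (rankCount C r H : ℝ) ≤ K * H ^ r ∨
        (r < n ∧ ∃ Y, IsNontrivialZero C Y ∧ ∀ i, |(Y i : ℝ)| ≤
          L * ((cubicHeight C * H) ^ r *
            ((cubicHeight C : ℝ) ^ (r + 1) * H ^ r) ^ (n - 1 - r))) := by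
  classical
  -- The constant in the gradient bound for bordered minors, with the powers of ‖C‖ and H removed.
  let B : ℝ := (r + 1) * (n * ((r + 1) * r.factorial * (6 * n) ^ (r + 1)))
  -- Cells: a choice of rows `e` and of a square subsystem. Their number depends only on n and r.
  let I := (Fin r → Fin n) × (Fin n → (Fin n × Fin n) ⊕ Fin n)
  refine ⟨Fintype.card I * (((r + 3 : ℕ) : ℝ) ^ n * 3 ^ r),
    n.factorial * ((6 * n) ^ r * B ^ (n - 1 - r)), by positivity, by positivity, ?_⟩
  intro C hC hM H hH
  have hH0 : 0 ≤ H := by linarith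
  have hn' : (1 : ℝ) ≤ n := by exact_mod_cast hn
  have hM' : (1 : ℝ) ≤ cubicHeight C := by exact_mod_cast hM
  by_cases hex : ∃ (x : Fin n → ℤ) (e : Fin r → Fin n) (Y : Fin n → ℝ),
      (∀ i, |(x i : ℝ)| ≤ H) ∧
      (((hessian C).map (MvPolynomial.eval x)).submatrix e e).det ≠ 0 ∧
      (borderedMinors C e).map (MvPolynomial.eval x) = 0 ∧ Y ≠ 0 ∧
      (∀ a, (fun j => (MvPolynomial.eval x (hessian C (e a) j) : ℝ)) ⬝ᵥ Y = 0) ∧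
      ∀ c : Fin n × Fin n, (fun i => (MvPolynomial.eval x
        (MvPolynomial.pderiv i (borderedMinors C e c.1 c.2)) : ℝ)) ⬝ᵥ Y = 0
  · right
    obtain ⟨x, e, Y, hx, hdet, h0, hY0, hYA, hYB⟩ := hex
    have hA : ∀ a j, |((MvPolynomial.eval x (hessian C (e a) j) : ℤ) : ℝ)| ≤
        6 * n * (cubicHeight C * H) := fun a j => by
      have := (PolyBound.hessian hC hH0 hx (e a) j).val
      rw [pow_one] at this
      linarith
    have hB : ∀ (c : Fin n × Fin n) i, |((MvPolynomial.eval x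
        (MvPolynomial.pderiv i (borderedMinors C e c.1 c.2)) : ℤ) : ℝ)| ≤
          B * ((cubicHeight C : ℝ) ^ (r + 1) * H ^ r) := fun c i => by
      have := (PolyBound.borderedMinors hC hH0 hx e c.1 c.2).der i
      refine le_of_mul_le_mul_left (this.trans (le_of_eq ?_)) (by linarith : 0 < H)
      simp only [B]
      push_cast
      ring
    have hB1 : 1 ≤ B * ((cubicHeight C : ℝ) ^ (r + 1) * H ^ r) := by
      have h1 : (1 : ℝ) ≤ r.factorial := by exact_mod_cast r.factorial_pos
      have h2 : (1 : ℝ) ≤ r + 1 := by linarith [(Nat.cast_nonneg r : (0 : ℝ) ≤ r)]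
      have h3 : (1 : ℝ) ≤ (6 * n) ^ (r + 1) := one_le_pow₀ (by linarith)
      exact one_le_mul_of_one_le_of_one_le
        (one_le_mul_of_one_le_of_one_le h2 (one_le_mul_of_one_le_of_one_le hn'
          (one_le_mul_of_one_le_of_one_le (one_le_mul_of_one_le_of_one_le h2 h1) h3)))
        (one_le_mul_of_one_le_of_one_le (one_le_pow₀ hM') (one_le_pow₀ hH))
    -- Independence is already visible after restricting to the columns `e`, where the minor is
    -- nonzero.
    have hind : LinearIndependent ℝ
        (fun (a : Fin r) j => ((MvPolynomial.eval x (hessian C (e a) j) : ℤ) : ℝ)) := by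
      refine LinearIndependent.of_comp (LinearMap.funLeft ℝ ℝ e) ?_
      have h1 : IsUnit ((((hessian C).map (MvPolynomial.eval x)).submatrix e e).map
          (Int.castRingHom ℝ)) := by
        rw [Matrix.isUnit_iff_isUnit_det]
        have h2 := (Int.castRingHom ℝ).map_det
          (((hessian C).map (MvPolynomial.eval x)).submatrix e e)
        rw [RingHom.mapMatrix_apply] at h2
        rw [← h2, isUnit_iff_ne_zero]
        simpa using hdet
      exact Matrix.linearIndependent_rows_iff_isUnit.mpr h1
    obtain ⟨hrn, Z, hZ0, hZA, hZB, hZ⟩ := exists_small_solution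
      (fun a j => MvPolynomial.eval x (hessian C (e a) j))
      (fun (c : Fin n × Fin n) i =>
        MvPolynomial.eval x (MvPolynomial.pderiv i (borderedMinors C e c.1 c.2)))
      _ _ hB1 hA hB hind ⟨Y, hY0, hYA, hYB⟩
    refine ⟨hrn, Z, ⟨hZ0, ?_⟩, fun i => (hZ i).trans (le_of_eq ?_)⟩
    · exact eval_eq_zero_of_tangent hC hdet h0 (funext fun a => hZA a) fun k l => hZB (k, l)
    · rw [mul_pow, mul_pow B]
      ring
  · left
    refine rankCount_le_of_forall_finset hH0 fun S hS => ?_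
    have hsel : ∀ x ∈ S, ∃ q : I, (Finset.univ.filter fun k => (q.2 k).isRight).card ≤ r ∧
        (∀ c : Fin n × Fin n, MvPolynomial.eval x (borderedMinors C q.1 c.1 c.2) = 0) ∧
        ∀ Y : Fin n → ℝ, (∀ k, Sum.elim (fun (c : Fin n × Fin n) i => (MvPolynomial.eval x
          (MvPolynomial.pderiv i (borderedMinors C q.1 c.1 c.2)) : ℝ))
          (fun i => Pi.single i 1) (q.2 k) ⬝ᵥ Y = 0) → Y = 0 := by
      intro x hx
      obtain ⟨e, hdet, h0⟩ := exists_minor_of_rank hC x (hS x hx).2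
      obtain ⟨g, hg, hgY⟩ := exists_square_subsystem
        (fun a j => (MvPolynomial.eval x (hessian C (e a) j) : ℝ))
        (fun (c : Fin n × Fin n) i => (MvPolynomial.eval x
          (MvPolynomial.pderiv i (borderedMinors C e c.1 c.2)) : ℝ)) fun Y hYA hYB => by
            by_contra hY0
            exact hex ⟨x, e, Y, (hS x hx).1, hdet, h0, hY0, hYA, hYB⟩
      exact ⟨(e, g), hg, fun c => congrFun (congrFun h0 c.1) c.2, hgY⟩
    have : Nonempty I := ⟨(fun _ => ⟨0, hn⟩, fun k => Sum.inr k)⟩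
    choose! q hq using hsel
    have hcell : ∀ p ∈ (Finset.univ : Finset I), ((S.filter fun x => q x = p).card : ℝ) ≤
        ((r + 3 : ℕ) : ℝ) ^ n * (3 * H) ^ r := by
      intro p _
      rcases (S.filter fun x => q x = p).eq_empty_or_nonempty with he | ⟨x₀, hx₀⟩
      · rw [he]
        simp only [Finset.card_empty, Nat.cast_zero]
        positivity
      · obtain ⟨hx₀S, hx₀p⟩ := Finset.mem_filter.mp hx₀
        refine card_le_of_nondegenerate (by omega)
          (fun c : Fin n × Fin n => borderedMinors C p.1 c.1 c.2) (fun c => ?_) p.2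
          (hx₀p ▸ (hq x₀ hx₀S).1) hH _ (fun x hx => (hS x (Finset.mem_filter.mp hx).1).1)
          (fun x hx => ?_) fun x hx => ?_
        · have := (PolyBound.borderedMinors hC hH0 (hS x₀ hx₀S).1 p.1 c.1 c.2).deg
          omega
        · obtain ⟨hxS, rfl⟩ := Finset.mem_filter.mp hx
          exact (hq x hxS).2.1
        · obtain ⟨hxS, rfl⟩ := Finset.mem_filter.mp hx
          exact (hq x hxS).2.2
    have hcard := Finset.card_eq_sum_card_fiberwise (f := q) (s := S) (t := Finset.univ)
      fun _ _ => Finset.mem_coe.mpr (Finset.mem_univ _)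
    rw [hcard]
    push_cast
    refine (Finset.sum_le_card_nsmul _ _ _ hcell).trans (le_of_eq ?_)
    rw [nsmul_eq_mul, Finset.card_univ, mul_pow]
    push_cast
    ring

/-! ### Exponents and conclusion -/

theorem leastZeroBound_le {n : ℕ} {C : MvPolynomial (Fin n) ℤ} {x : Fin n → ℤ} {B : ℝ}
    (hx : IsNontrivialZero C x) (hB : ∀ i, |(x i : ℝ)| ≤ B) : (leastZeroBound C : ℝ) ≤ B := by
  obtain ⟨i, hi⟩ := Function.ne_iff.mp hx.1
  have h1 : (1 : ℝ) ≤ |(x i : ℝ)| := by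
    rw [← Int.cast_abs]
    exact_mod_cast Int.one_le_abs hi
  have hB0 : 0 ≤ B := by linarith [hB i]
  have hmem : leastZeroBound C ≤ ⌊B⌋₊ := by
    refine Nat.sInf_le ⟨Nat.floor_pos.mpr (h1.trans (hB i)), fun _ => ⟨x, hx, ?_⟩⟩
    rw [pi_norm_le_iff_of_nonneg (by positivity)]
    intro j
    have h2 : (x j).natAbs ≤ ⌊B⌋₊ := Nat.le_floor (by
      rw [Nat.cast_natAbs, Int.cast_abs]
      exact hB j)
    rw [Int.norm_eq_abs, ← Int.cast_abs, Int.abs_eq_natAbs]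
    exact_mod_cast h2
  exact (Nat.cast_le.mpr hmem).trans (Nat.floor_le hB0)

/-- With s = n - 1 - r the exponents of M and H are r + (r+1)s and r + rs. The required bounds
reduce to 1 ≤ r² + s², which holds as r + s ≥ 2, and r ≤ r² + s² + s. -/
theorem pow_mul_pow_le_rpow {n r : ℕ} (hn : 3 ≤ n) (hr : r < n) {M H ψ : ℝ} (hM : 1 ≤ M)
    (hH : 1 ≤ H) (hψ : 1 ≤ ψ) (hHM : H ≤ M ^ ψ) :
    (M * H) ^ r * (M ^ (r + 1) * H ^ r) ^ (n - 1 - r) ≤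
      M ^ ((n : ℝ) ^ 2 / 2 - 1 + ψ * (n : ℝ) * ((n : ℝ) - 1) / 2) := by
  obtain ⟨s, rfl⟩ : ∃ s, n = r + 1 + s := ⟨n - (r + 1), by omega⟩
  have hs : r + 1 + s - 1 - r = s := by omega
  have hM0 : 0 ≤ M := by linarith
  rw [hs]
  calc (M * H) ^ r * (M ^ (r + 1) * H ^ r) ^ s
      = M ^ (r + (r + 1) * s) * H ^ (r + r * s) := by
        rw [mul_pow, mul_pow, ← pow_mul, ← pow_mul, pow_add, pow_add]; ring
    _ ≤ M ^ (r + (r + 1) * s) * (M ^ ψ) ^ (r + r * s) := by gcongr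
    _ = M ^ ((r + (r + 1) * s : ℕ) + ψ * (r + r * s : ℕ) : ℝ) := by
        rw [Real.rpow_add (by linarith), Real.rpow_natCast, Real.rpow_mul hM0, Real.rpow_natCast]
    _ ≤ _ := by
        refine Real.rpow_le_rpow_of_exponent_le hM ?_
        have h1 : 2 * (r + (r + 1) * s) + 2 ≤ (r + 1 + s) ^ 2 := by
          rcases Nat.eq_zero_or_pos r with rfl | hr0
          · nlinarith
          · nlinarith
        have h2 : 2 * (r + r * s) ≤ (r + 1 + s) * (r + s) := by
          rcases Nat.eq_zero_or_pos r with rfl | hr0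
          · simp
          · nlinarith
        have h1' : (2 : ℝ) * (r + (r + 1) * s) + 2 ≤ (r + 1 + s) ^ 2 := by exact_mod_cast h1
        have h2' : (2 : ℝ) * (r + r * s) ≤ (r + 1 + s) * (r + s) := by exact_mod_cast h2
        have h3 := mul_le_mul_of_nonneg_left h2' (by linarith : 0 ≤ ψ)
        push_cast
        nlinarith

theorem proposition2p1 (n : ℕ) (hn : 3 ≤ n) :
    ∃ (K : ℝ → ℝ) (L : ℝ), ∀ C : MvPolynomial (Fin n) ℤ, C.IsHomogeneous 3 →
      ∀ ψ : ℝ, 1 ≤ ψ →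
        IsPsiGood K ψ C ∨
          ((∃ x, IsNontrivialZero C x) ∧
            (leastZeroBound C : ℝ) ≤
              L * (cubicHeight C : ℝ) ^
                ((n : ℝ) ^ 2 / 2 - 1 + ψ * (n : ℝ) * ((n : ℝ) - 1) / 2)) := by
  choose K L hK hL hKL using fun r => rankCount_le_or_exists_zero n r (by omega)
  refine ⟨fun _ => ∑ r ∈ Finset.range (n + 1), K r, ∑ r ∈ Finset.range (n + 1), L r,
    fun C hC ψ hψ => ?_⟩
  by_cases hgood : IsPsiGood (fun _ => ∑ r ∈ Finset.range (n + 1), K r) ψ C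
  · exact Or.inl hgood
  right
  unfold IsPsiGood at hgood
  push Not at hgood
  obtain ⟨ε, hε, r, hr, H, hH, hHM, hcount⟩ := hgood
  -- The zero form is vacuously good: 0^ψ = 0 leaves no admissible H ≥ 1.
  have hM : 1 ≤ cubicHeight C := by
    rw [Nat.one_le_iff_ne_zero]
    intro h0
    rw [h0, Nat.cast_zero, Real.zero_rpow (by linarith)] at hHM
    linarith
  have hM' : (1 : ℝ) ≤ cubicHeight C := by exact_mod_cast hM
  have hrmem : r ∈ Finset.range (n + 1) := Finset.mem_range.mpr (by omega)
  rcases hKL r C hC hM H hH with h | ⟨hrn, Y, hY, hYb⟩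
  · exfalso
    have h1 : K r ≤ ∑ r ∈ Finset.range (n + 1), K r :=
      Finset.single_le_sum (fun i _ => hK i) hrmem
    have h2 : H ^ r ≤ H ^ ((r : ℝ) + ε) := by
      rw [← Real.rpow_natCast]
      exact Real.rpow_le_rpow_of_exponent_le hH (by linarith)
    have h3 : K r * H ^ r ≤ (∑ r ∈ Finset.range (n + 1), K r) * H ^ ((r : ℝ) + ε) :=
      mul_le_mul h1 h2 (by positivity) ((hK r).trans h1)
    linarith
  · refine ⟨⟨Y, hY⟩, leastZeroBound_le hY fun i => (hYb i).trans ?_⟩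
    have h1 : L r ≤ ∑ r ∈ Finset.range (n + 1), L r :=
      Finset.single_le_sum (fun i _ => hL i) hrmem
    exact mul_le_mul h1 (pow_mul_pow_le_rpow hn hrn hM' hH hψ hHM) (by positivity)
      ((hL r).trans h1)
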